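/- Let $S$ be a finite set of points in the Euclidean plane in general position, that is, no three points of $S$ lie on a line. A *$k$-hole* of $S$ is a convex polygon whose vertices are $k$ points of $S$ and whose interior contains no point of $S$. A *pseudo-triangle* is a simple polygon with exactly three vertices at which the interior angle is less than $180^\circ$; an *empty $\ell$-pseudo-triangle* of $S$ is a pseudo-triangle whose vertices are $\ell$ points of $S$ and whose interior contains no point of $S$. Let $E(k,\ell)$ denote the smallest integer such that every finite set of at least $E(k,\ell)$ points in the plane in general position has a $k$-hole or an empty $\ell$-pseudo-triangle. **Theorem.** The number $E(6,6)$ exists, and $$12 \le E(6,6) \le 18.$$ -/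

import Mathlib

/-- The Euclidean plane. -/
abbrev Plane : Type := EuclideanSpace ℝ (Fin 2)

/-- A finite set of points in the plane, no three of them on a line. -/
def InGeneralPosition (S : Finset Plane) : Prop :=
  ∀ a ∈ S, ∀ b ∈ S, ∀ c ∈ S, a ≠ b → b ≠ c → a ≠ c → ¬ Collinear ℝ {a, b, c}

/-- `S` contains a `k`-hole: `k` of its points are the vertices of a convex polygon that has no
point of `S` in its interior. -/
def HasHole (k : ℕ) (S : Finset Plane) : Prop :=
  ∃ T ⊆ S, T.card = k ∧ ConvexIndependent ℝ ((↑) : T → Plane) ∧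
    ∀ x ∈ S, x ∉ interior (convexHull ℝ (T : Set Plane))

namespace Polygon

/-- A simple polygon: at least three vertices, pairwise distinct, and two different edges meet only
in a common endpoint, if they follow each other along the polygon, and not at all otherwise. -/
def IsSimple {n : ℕ} (P : Polygon Plane n) : Prop :=
  3 ≤ n ∧ Function.Injective P.vertices ∧
    ∀ i j : Fin n, i ≠ j → ∀ x ∈ P.edgeSet ℝ i ∩ P.edgeSet ℝ j,
      (j = finRotate n i ∧ x = P j) ∨ (i = finRotate n j ∧ x = P i)

/-- The interior of a simple polygon: the points off the boundary whose connected component in the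
complement of the boundary is bounded. -/
def inside {n : ℕ} (P : Polygon Plane n) : Set Plane :=
  {x | x ∉ P.boundary ℝ ∧ Bornology.IsBounded (connectedComponentIn (P.boundary ℝ)ᶜ x)}

/-- The open angular sector at the `i`-th vertex spanned by the two edges at this vertex, on the
side where they make an angle of less than `180` degrees (contained in the line of these edges if
they make an angle of `180` degrees). -/
def convexSector {n : ℕ} (P : Polygon Plane n) (i : Fin n) : Set Plane :=
  {x | ∃ s t : ℝ, 0 < s ∧ 0 < t ∧
    x = P i + s • (P ((finRotate n).symm i) - P i) + t • (P (finRotate n i) - P i)}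

/-- The interior angle of a simple polygon at its `i`-th vertex is less than `180` degrees. Close
to a vertex, the two edges at it cut the plane into two sectors, and the interior of the polygon is
one of them; the angle is less than `180` degrees exactly if it is the convex one. -/
def IsConvexVertex {n : ℕ} (P : Polygon Plane n) (i : Fin n) : Prop :=
  ∃ ε > 0, ∀ x ∈ P.inside, dist x (P i) < ε → x ∈ P.convexSector i

/-- A pseudo-triangle: a simple polygon with exactly three vertices at which the interior angle is
less than `180` degrees. -/
def IsPseudoTriangle {n : ℕ} (P : Polygon Plane n) : Prop :=
  P.IsSimple ∧ {i : Fin n | P.IsConvexVertex i}.ncard = 3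

end Polygon

/-- `S` contains an empty `l`-pseudo-triangle: `l` of its points are the vertices of a
pseudo-triangle that has no point of `S` in its interior. -/
def HasEmptyPseudoTriangle (l : ℕ) (S : Finset Plane) : Prop :=
  ∃ P : Polygon Plane l, (∀ i, P i ∈ S) ∧ P.IsPseudoTriangle ∧ ∀ x ∈ S, x ∉ P.inside

/-- The numbers `n` such that every finite set of at least `n` points in general position in the
plane contains a `k`-hole or an empty `l`-pseudo-triangle. -/
def holeOrPseudoTriangleSizes (k l : ℕ) : Set ℕ :=
  {n | ∀ S : Finset Plane, n ≤ S.card → InGeneralPosition S →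
    HasHole k S ∨ HasEmptyPseudoTriangle l S}

/-- `E(k, l)`, the least integer such that every finite set of at least `E(k, l)` points in general
position in the plane contains a `k`-hole or an empty `l`-pseudo-triangle. (It would be `0` if there
were no such integer.) -/
noncomputable def E (k l : ℕ) : ℕ := sInf (holeOrPseudoTriangleSizes k l)

/-! The proof turns on whether some triangle with vertices in `S` has at least three points of `S`
inside.

Suppose none has. A fan triangulation of the convex hull then gives |S| - h ≤ 2(h - 2) for the
number h of hull vertices (`card_le_of_card_triPoints_le`), so eighteen points force h ≥ 8. Among
the convex octagons take one with the fewest points inside. No interior point lies in an ear cut off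
by a short diagonal, since it could replace the vertex of that ear. Hence all of them lie in the
quadrilateral of every other vertex, which is two triangles, and there are at most four
(`card_interiorPoints_le_four`). Such an octagon yields a 6-hole: distinguish cases by the hull of
the interior points and count the octagon vertices beyond its edges (`hasHole_of_card_le_four`).

Suppose some triangle has three points inside, and let A B C have the fewest among these. If
interior points p, q, r are such that the triangles A p B, B q C, C r A overlap only in A, B, C and
contain all other interior points, then the hexagon A p B q C r is an empty pseudo-triangle
(`IsStar.hasEmptyPseudoTriangle`). By minimality, each triangle spanned by an edge of A B C and an
interior point (a pocket) holds at most two points. This leaves at most five interior points, and p,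
q, r are found by a purely order-theoretic argument about the three angular orders around A, B and C
(`IsPocketSystem.hasPocketTriple`).

For the lower bound, eleven explicit points have at most two points in each triangle and no six
points whose triangles are all empty. The latter excludes 6-holes. A hull vertex of a simple polygon
is a convex vertex (`Polygon.IsSimple.isConvexVertex_of_mem_extremePoints`), so the hull of a
pseudo-triangle with six vertices has at most three vertices, and the same fan count would put three
points into one triangle (`exists_three_le_card_triPoints`). -/

/-! ### Orientations, half-planes and convex hulls. -/

/-- Twice the signed area of the triangle `a b c`; positive if it is oriented counterclockwise. -/
def orient (a b c : Plane) : ℝ :=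
  (b 0 - a 0) * (c 1 - a 1) - (b 1 - a 1) * (c 0 - a 0)

theorem plane_ext {x y : Plane} (h0 : x 0 = y 0) (h1 : x 1 = y 1) : x = y := by
  ext i
  fin_cases i
  · exact h0
  · exact h1

theorem orient_rotate (a b c : Plane) : orient b c a = orient a b c := by
  unfold orient; ring

theorem orient_swap (a b c : Plane) : orient b a c = -orient a b c := by
  unfold orient; ring

theorem orient_swap_right (a b c : Plane) : orient a c b = -orient a b c := by
  unfold orient; ring

@[simp] theorem orient_self_left (a b : Plane) : orient a a b = 0 := by
  unfold orient; ring

@[simp] theorem orient_self_right (a b : Plane) : orient a b b = 0 := by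
  unfold orient; ring

@[simp] theorem orient_self_outer (a b : Plane) : orient a b a = 0 := by
  unfold orient; ring

theorem orient_combo (a b x y : Plane) {s t : ℝ} (h : s + t = 1) :
    orient a b (s • x + t • y) = s * orient a b x + t * orient a b y := by
  obtain rfl : s = 1 - t := by linarith
  simp only [orient, PiLp.add_apply, PiLp.smul_apply, smul_eq_mul]; ring

@[fun_prop]
theorem continuous_orient (a b : Plane) : Continuous (orient a b) := by
  unfold orient; fun_prop

theorem collinear_iff_orient_eq_zero {a b c : Plane} :
    Collinear ℝ {a, b, c} ↔ orient a b c = 0 := by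
  constructor
  · intro h
    rw [collinear_iff_of_mem (p₀ := a) (by simp)] at h
    obtain ⟨v, hv⟩ := h
    obtain ⟨s, hs⟩ := hv b (by simp)
    obtain ⟨t, ht⟩ := hv c (by simp)
    subst hs ht
    simp only [orient, vadd_eq_add, PiLp.add_apply, PiLp.smul_apply, smul_eq_mul]
    ring
  · intro h
    by_cases hab : a = b
    · subst hab
      simpa using collinear_pair ℝ a c
    rw [collinear_iff_of_mem (p₀ := a) (by simp)]
    have hd : 0 < (b 0 - a 0) ^ 2 + (b 1 - a 1) ^ 2 := by
      by_contra hcon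
      apply hab
      apply plane_ext <;> nlinarith [sq_nonneg (b 0 - a 0), sq_nonneg (b 1 - a 1)]
    refine ⟨b - a, ?_⟩
    simp only [Set.mem_insert_iff, Set.mem_singleton_iff, forall_eq_or_imp, forall_eq]
    refine ⟨⟨0, by simp⟩, ⟨1, by simp⟩, ⟨((c 0 - a 0) * (b 0 - a 0) + (c 1 - a 1) * (b 1 - a 1)) /
      ((b 0 - a 0) ^ 2 + (b 1 - a 1) ^ 2), ?_⟩⟩
    unfold orient at h
    apply plane_ext <;>
      simp only [vadd_eq_add, PiLp.add_apply, PiLp.smul_apply, PiLp.sub_apply, smul_eq_mul] <;>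
      field_simp
    · linear_combination -(b 1 - a 1) * h
    · linear_combination (b 0 - a 0) * h

theorem InGeneralPosition.orient_ne_zero {S : Finset Plane} (hS : InGeneralPosition S)
    {a b c : Plane} (ha : a ∈ S) (hb : b ∈ S) (hc : c ∈ S) (hab : a ≠ b) (hbc : b ≠ c)
    (hac : a ≠ c) : orient a b c ≠ 0 :=
  fun h => hS a ha b hb c hc hab hbc hac (collinear_iff_orient_eq_zero.2 h)

theorem InGeneralPosition.mono {S T : Finset Plane} (hS : InGeneralPosition S) (h : T ⊆ S) :
    InGeneralPosition T :=
  fun a ha b hb c hc => hS a (h ha) b (h hb) c (h hc)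

theorem convex_orient_ge (a b : Plane) (r : ℝ) : Convex ℝ {x | r ≤ orient a b x} := by
  intro x hx y hy s t hs ht hst
  simp only [Set.mem_ofPred_eq] at *
  rw [orient_combo a b x y hst]
  obtain rfl : s = 1 - t := by linarith
  nlinarith [mul_le_mul_of_nonneg_left hx hs, mul_le_mul_of_nonneg_left hy ht]

theorem convex_orient_gt (a b : Plane) (r : ℝ) : Convex ℝ {x | r < orient a b x} := by
  intro x hx y hy s t hs ht hst
  simp only [Set.mem_ofPred_eq] at *
  rw [orient_combo a b x y hst]
  rcases hs.eq_or_lt with rfl | hs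
  · obtain rfl : t = 1 := by linarith
    linarith
  · obtain rfl : s = 1 - t := by linarith
    nlinarith [mul_lt_mul_of_pos_left hx hs, mul_le_mul_of_nonneg_left hy.le ht]

theorem orient_nonneg_of_mem_convexHull {a b x : Plane} {T : Set Plane} {r : ℝ}
    (h : ∀ t ∈ T, r ≤ orient a b t) (hx : x ∈ convexHull ℝ T) : r ≤ orient a b x :=
  convexHull_min (fun t ht => h t ht) (convex_orient_ge a b r) hx

/-- This convex set contains the hull of any points of which all except `u` lie strictly left of the
line at level `r`; so the hull can meet that line only in `u`. -/
theorem convex_insert_orient_gt {a b u : Plane} {r : ℝ} (hu : r ≤ orient a b u) :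
    Convex ℝ {x | x = u ∨ r < orient a b x} := by
  have seg : ∀ y, r < orient a b y → ∀ s t : ℝ, 0 ≤ s → 0 ≤ t → s + t = 1 →
      s • u + t • y = u ∨ r < orient a b (s • u + t • y) := by
    intro y hy s t hs ht hst
    rcases ht.eq_or_lt with rfl | ht
    · left
      obtain rfl : s = 1 := by linarith
      simp
    · right
      rw [orient_combo a b u y hst]
      obtain rfl : s = 1 - t := by linarith
      nlinarith [mul_lt_mul_of_pos_left hy ht, mul_le_mul_of_nonneg_left hu hs]
  rintro x hx y hy s t hs ht hst
  rcases hx with rfl | hx <;> rcases hy with rfl | hy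
  · left
    rw [← add_smul, hst, one_smul]
  · exact seg y hy s t hs ht hst
  · have := seg x hx t s ht hs (by linarith)
    rwa [add_comm (t • _)] at this
  · exact Or.inr (convex_orient_gt a b r hx hy hs ht hst)

/-- Take the right-hand normal of the line, divided by the squared length of `b - a`. It serves to
step out of a half-plane. -/
theorem exists_orient_direction {a b : Plane} (hab : a ≠ b) :
    ∃ d : Plane, ∀ x t, orient a b (x + t • d) = orient a b x - t := by
  have hd : 0 < (b 0 - a 0) ^ 2 + (b 1 - a 1) ^ 2 := by
    by_contra hcon
    apply hab
    apply plane_ext <;> nlinarith [sq_nonneg (b 0 - a 0), sq_nonneg (b 1 - a 1)]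
  refine ⟨!₂[(b 1 - a 1) / ((b 0 - a 0) ^ 2 + (b 1 - a 1) ^ 2),
    -(b 0 - a 0) / ((b 0 - a 0) ^ 2 + (b 1 - a 1) ^ 2)], fun x t => ?_⟩
  simp [orient]
  field_simp
  ring

/-- A point of the plane where an oriented line attains its minimum over a set is not interior to
the convex hull of the set. -/
theorem not_mem_interior_convexHull {a b x : Plane} {T : Set Plane} (hab : a ≠ b)
    (hx : ∀ t ∈ T, orient a b x ≤ orient a b t) : x ∉ interior (convexHull ℝ T) := by
  intro h
  obtain ⟨d, hd⟩ := exists_orient_direction hab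
  have hc : Continuous fun t : ℝ => x + t • d := by fun_prop
  have h0 : (fun t : ℝ => x + t • d) ⁻¹' interior (convexHull ℝ T) ∈ nhds (0 : ℝ) :=
    (isOpen_interior.preimage hc).mem_nhds (by simpa using h)
  obtain ⟨ε, hε, hball⟩ := Metric.mem_nhds_iff.1 h0
  have hm : ε / 2 ∈ Metric.ball (0 : ℝ) ε := by
    simp [abs_of_pos hε, hε]
  have := orient_nonneg_of_mem_convexHull hx (interior_subset (hball hm))
  rw [hd] at this
  linarith

/-- The point `x` lies in the interior of the counterclockwise triangle `a b c`. -/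
def InTri (a b c x : Plane) : Prop :=
  0 < orient a b x ∧ 0 < orient b c x ∧ 0 < orient c a x

theorem InTri.rotate {a b c x : Plane} (h : InTri a b c x) : InTri b c a x :=
  ⟨h.2.1, h.2.2, h.1⟩

/-- The three areas add up to that of the triangle. So `InTri` holds for no point when the triple is
clockwise or collinear. -/
theorem InTri.orient_pos {a b c x : Plane} (h : InTri a b c x) : 0 < orient a b c := by
  have hs : orient a b c = orient a b x + orient b c x + orient c a x := by
    unfold orient; ring
  linarith [h.1, h.2.1, h.2.2]

theorem isOpen_inTri (a b c : Plane) : IsOpen {x | InTri a b c x} :=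
  ((isOpen_lt continuous_const (continuous_orient a b)).inter
    ((isOpen_lt continuous_const (continuous_orient b c)).inter
      (isOpen_lt continuous_const (continuous_orient c a))))

theorem mem_convexHull_triple_of_orient_nonneg {a b c x : Plane} (h : 0 < orient a b c)
    (h1 : 0 ≤ orient a b x) (h2 : 0 ≤ orient b c x) (h3 : 0 ≤ orient c a x) :
    x ∈ convexHull ℝ ({a, b, c} : Set Plane) := by
  have hs : orient a b c = orient a b x + orient b c x + orient c a x := by
    unfold orient; ring
  have key : x = (orient b c x / orient a b c) • a + (orient c a x / orient a b c) • b +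
      (orient a b x / orient a b c) • c := by
    apply plane_ext <;> simp only [PiLp.add_apply, PiLp.smul_apply, smul_eq_mul] <;>
      field_simp <;> unfold orient <;> ring
  have hmem := (convex_convexHull ℝ ({a, b, c} : Set Plane)).sum_mem (t := Finset.univ)
    (w := ![orient b c x / orient a b c, orient c a x / orient a b c, orient a b x / orient a b c])
    (z := ![a, b, c]) ?_ ?_ ?_
  · rw [key]
    simpa [Fin.sum_univ_three] using hmem
  · intro i _
    fin_cases i <;> simp <;> positivity
  · simp [Fin.sum_univ_three]
    field_simp
    linarith
  · intro i _
    apply subset_convexHull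
    fin_cases i <;> simp

theorem InTri.mem_interior_convexHull {a b c x : Plane} {T : Set Plane} (h : InTri a b c x)
    (ha : a ∈ convexHull ℝ T) (hb : b ∈ convexHull ℝ T) (hc : c ∈ convexHull ℝ T) :
    x ∈ interior (convexHull ℝ T) := by
  refine interior_maximal (t := {x | InTri a b c x}) ?_ (isOpen_inTri a b c) h
  intro y hy
  refine convexHull_min ?_ (convex_convexHull ℝ T) (mem_convexHull_triple_of_orient_nonneg
    hy.orient_pos hy.1.le hy.2.1.le hy.2.2.le)
  rintro z (rfl | rfl | rfl) <;> assumption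

theorem not_mem_interior_of_mem_extremePoints {x : Plane} {C : Set Plane}
    (hx : x ∈ C.extremePoints ℝ) : x ∉ interior C := by
  intro h
  let d : Plane := !₂[1, 0]
  have hc : Continuous fun t : ℝ => x + t • d := by fun_prop
  have h0 : (fun t : ℝ => x + t • d) ⁻¹' interior C ∈ nhds (0 : ℝ) :=
    (isOpen_interior.preimage hc).mem_nhds (by simpa using h)
  obtain ⟨ε, hε, hball⟩ := Metric.mem_nhds_iff.1 h0
  have h1 : x + (ε / 2) • d ∈ C :=
    interior_subset (hball (by simp [abs_of_pos hε, hε] : ε / 2 ∈ Metric.ball (0 : ℝ) ε))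
  have h2 : x + (-(ε / 2)) • d ∈ C :=
    interior_subset (hball (by simp [abs_of_pos hε, hε] : -(ε / 2) ∈ Metric.ball (0 : ℝ) ε))
  have := hx.2 h1 h2 ⟨1 / 2, 1 / 2, by norm_num, by norm_num, by norm_num, by module⟩
  have h3 := congrArg (fun v : Plane => v 0) this
  simp [d] at h3
  linarith

theorem Finset.convexHull_extremePoints (T : Finset Plane) :
    convexHull ℝ ((convexHull ℝ (T : Set Plane)).extremePoints ℝ) = convexHull ℝ (T : Set Plane) := by
  have hfin : ((convexHull ℝ (T : Set Plane)).extremePoints ℝ).Finite :=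
    T.finite_toSet.subset extremePoints_convexHull_subset
  have := closure_convexHull_extremePoints (T.finite_toSet.isCompact_convexHull ℝ)
    (convex_convexHull ℝ (T : Set Plane))
  rwa [(hfin.isClosed_convexHull ℝ).closure_eq] at this

theorem mem_extremePoints_of_convexIndependent {T : Finset Plane}
    (hT : ConvexIndependent ℝ ((↑) : T → Plane)) {t : Plane} (ht : t ∈ T) :
    t ∈ (convexHull ℝ (T : Set Plane)).extremePoints ℝ := by
  by_contra hcon
  refine (convexIndependent_set_iff_notMem_convexHull_sdiff (s := (T : Set Plane))).1 hT t ht ?_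
  refine convexHull_mono ?_ (T.convexHull_extremePoints.symm ▸ subset_convexHull ℝ _ ht)
  exact fun y hy => ⟨extremePoints_convexHull_subset hy, fun h => hcon (h ▸ hy)⟩

theorem notMem_convexHull_sdiff_of_mem_extremePoints {C A : Set Plane} (hC : Convex ℝ C)
    (hA : A ⊆ C) {t : Plane} (ht : t ∈ C.extremePoints ℝ) : t ∉ convexHull ℝ (A \ {t}) := by
  intro h
  have h1 := (hC.mem_extremePoints_iff_mem_sdiff_convexHull_sdiff.1 ht).2
  exact h1 (convexHull_mono (Set.sdiff_subset_sdiff_left hA) h)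

/-- A set of vertices of a convex polygon and interior points spans a hole if every interior point
is weakly separated from it by a line through two points. -/
theorem hasHole_of_supporting_lines {S T H : Finset Plane} (hS : InGeneralPosition S)
    (hTS : T ⊆ S) (hT : ConvexIndependent ℝ ((↑) : T → Plane))
    (hH : ∀ t ∈ H, t ∈ T ∨ (t ∈ S ∧ t ∈ interior (convexHull ℝ (T : Set Plane))))
    (hsep : ∀ x ∈ S, x ∈ interior (convexHull ℝ (T : Set Plane)) →
      ∃ p ∈ S, ∃ q ∈ S, p ≠ q ∧ orient p q x ≤ 0 ∧ ∀ t ∈ H, 0 ≤ orient p q t) :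
    HasHole H.card S := by
  have hHS : H ⊆ S := fun t ht => (hH t ht).elim (fun h => hTS h) (fun h => h.1)
  have hHC : (H : Set Plane) ⊆ convexHull ℝ (T : Set Plane) := fun t ht =>
    (hH t ht).elim (fun h => subset_convexHull ℝ _ h) (fun h => interior_subset h.2)
  refine ⟨H, hHS, rfl, ?_, ?_⟩
  · refine (convexIndependent_set_iff_notMem_convexHull_sdiff (s := (H : Set Plane))).2 fun t ht => ?_
    rcases hH t ht with h | h
    · exact notMem_convexHull_sdiff_of_mem_extremePoints (convex_convexHull ℝ _) hHC
        (mem_extremePoints_of_convexIndependent hT h)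
    · obtain ⟨p, hp, q, hq, hpq, hle, hall⟩ := hsep t h.1 h.2
      have h0 : orient p q t = 0 := le_antisymm hle (hall t ht)
      have htpq : t = p ∨ t = q := by
        by_contra hne
        push Not at hne
        exact hS.orient_ne_zero hp hq h.1 hpq hne.2.symm hne.1.symm h0
      -- the other point of the line through `p` and `q`
      obtain ⟨u, hut, hu0, hu⟩ : ∃ u, u ≠ t ∧ 0 ≤ orient p q u ∧ 
          ∀ s ∈ H, s ≠ t → s ≠ u → 0 < orient p q s := by
        have hpos : ∀ s ∈ H, s ≠ p → s ≠ q → 0 < orient p q s := fun s hs h1 h2 =>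
          lt_of_le_of_ne (hall s hs) (hS.orient_ne_zero hp hq (hHS hs) hpq h2.symm h1.symm).symm
        rcases htpq with rfl | rfl
        · exact ⟨q, hpq.symm, by simp, fun s hs h1 h2 => hpos s hs h1 h2⟩
        · exact ⟨p, hpq, by simp, fun s hs h1 h2 => hpos s hs h2 h1⟩
      intro hmem
      have hsub : (H : Set Plane) \ {t} ⊆ {y | y = u ∨ 0 < orient p q y} := by
        rintro s ⟨hs, hst⟩
        by_cases hsu : s = u
        · exact Or.inl hsu
        · exact Or.inr (hu s hs hst hsu)
      rcases convexHull_min hsub (convex_insert_orient_gt hu0) hmem with h1 | h1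
      · exact hut h1.symm
      · exact h1.ne' h0
  · intro x hx hxi
    obtain ⟨p, hp, q, hq, hpq, hle, hall⟩ := hsep x hx
      (interior_mono (convexHull_min hHC (convex_convexHull ℝ _)) hxi)
    exact not_mem_interior_convexHull hpq (fun t ht => hle.trans (hall t ht)) hxi

/-! ### Convex octagons with at most four interior points. -/

/-- The points of `S` in the interior of the convex hull of `T`. -/
noncomputable def interiorPoints (S T : Finset Plane) : Finset Plane :=
  open Classical in S.filter (· ∈ interior (convexHull ℝ (T : Set Plane)))

theorem mem_interiorPoints {S T : Finset Plane} {x : Plane} :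
    x ∈ interiorPoints S T ↔ x ∈ S ∧ x ∈ interior (convexHull ℝ (T : Set Plane)) := by
  simp [interiorPoints]

/-- A convex polygon with vertices in a point set in general position. -/
structure IsConvexPolygon (S T : Finset Plane) : Prop where
  generalPosition : InGeneralPosition S
  subset : T ⊆ S
  convexIndependent : ConvexIndependent ℝ ((↑) : T → Plane)

namespace IsConvexPolygon

variable {S T : Finset Plane}

theorem disjoint_interiorPoints (h : IsConvexPolygon S T) : Disjoint T (interiorPoints S T) := by
  rw [Finset.disjoint_left]
  intro t ht hti
  exact not_mem_interior_of_mem_extremePoints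
    (mem_extremePoints_of_convexIndependent h.convexIndependent ht) (mem_interiorPoints.1 hti).2

theorem ne_of_mem (h : IsConvexPolygon S T) {t x : Plane} (ht : t ∈ T)
    (hx : x ∈ interiorPoints S T) : t ≠ x := by
  rintro rfl
  exact Finset.disjoint_left.1 h.disjoint_interiorPoints ht hx

theorem orient_ne_zero (h : IsConvexPolygon S T) {t x y : Plane} (ht : t ∈ T)
    (hx : x ∈ interiorPoints S T) (hy : y ∈ interiorPoints S T) (hxy : x ≠ y) :
    orient x y t ≠ 0 :=
  h.generalPosition.orient_ne_zero (mem_interiorPoints.1 hx).1 (mem_interiorPoints.1 hy).1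
    (h.subset ht) hxy (h.ne_of_mem ht hy).symm (h.ne_of_mem ht hx).symm

theorem not_inTri (h : IsConvexPolygon S T) {t x y z : Plane} (ht : t ∈ T)
    (hx : x ∈ interiorPoints S T) (hy : y ∈ interiorPoints S T) (hz : z ∈ interiorPoints S T) :
    ¬ InTri x y z t := fun hin =>
  not_mem_interior_of_mem_extremePoints
    (mem_extremePoints_of_convexIndependent h.convexIndependent ht)
    (hin.mem_interior_convexHull (interior_subset (mem_interiorPoints.1 hx).2)
      (interior_subset (mem_interiorPoints.1 hy).2) (interior_subset (mem_interiorPoints.1 hz).2))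

/-- More than six points may be supplied: surplus vertices are dropped from `A`, which preserves the
separation, whereas all of `J` is kept. -/
theorem hasHole_six (h : IsConvexPolygon S T) {J A : Finset Plane}
    (hJ : J ⊆ interiorPoints S T) (hA : A ⊆ T) (hJ6 : J.card ≤ 6) (hcard : 6 ≤ J.card + A.card)
    (hsep : ∀ x ∈ interiorPoints S T, ∃ p ∈ S, ∃ q ∈ S, p ≠ q ∧ orient p q x ≤ 0 ∧
      (∀ t ∈ J, 0 ≤ orient p q t) ∧ ∀ t ∈ A, 0 ≤ orient p q t) : HasHole 6 S := by
  classical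
  obtain ⟨A', hA', hc⟩ := Finset.exists_subset_card_eq (show 6 - J.card ≤ A.card by omega)
  have hd : Disjoint J A' :=
    (h.disjoint_interiorPoints.mono (hA'.trans hA) hJ).symm
  have h6 : (J ∪ A').card = 6 := by
    rw [Finset.card_union_of_disjoint hd]; omega
  rw [← h6]
  refine hasHole_of_supporting_lines h.generalPosition h.subset h.convexIndependent ?_ ?_
  · intro t ht
    rcases Finset.mem_union.1 ht with ht | ht
    · exact Or.inr (mem_interiorPoints.1 (hJ ht))
    · exact Or.inl (hA (hA' ht))
  · intro x hx hxi
    obtain ⟨p, hp, q, hq, hpq, hle, h1, h2⟩ := hsep x (mem_interiorPoints.2 ⟨hx, hxi⟩)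
    refine ⟨p, hp, q, hq, hpq, hle, fun t ht => ?_⟩
    rcases Finset.mem_union.1 ht with ht | ht
    · exact h1 t ht
    · exact h2 t (hA' ht)

open Classical in
/-- The vertices of `T` strictly to the right of the directed line `x y`. -/
noncomputable def _root_.beyond (T : Finset Plane) (x y : Plane) : Finset Plane :=
  T.filter (fun t => orient x y t < 0)

theorem _root_.mem_beyond {x y t : Plane} : t ∈ beyond T x y ↔ t ∈ T ∧ orient x y t < 0 := by
  simp [beyond]

theorem pos_of_notMem_beyond (h : IsConvexPolygon S T) {t x y : Plane} (ht : t ∈ T)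
    (hx : x ∈ interiorPoints S T) (hy : y ∈ interiorPoints S T) (hxy : x ≠ y)
    (hb : t ∉ beyond T x y) : 0 < orient x y t := by
  rcases lt_or_gt_of_ne (h.orient_ne_zero ht hx hy hxy) with h1 | h1
  · exact absurd (mem_beyond.2 ⟨ht, h1⟩) hb
  · exact h1

/-- Four vertices beyond `x y`, together with `x` and `y`, would form a 6-hole: the line through `x`
and `y` separates it from all interior points. -/
theorem card_beyond_le (h : IsConvexPolygon S T) (hno : ¬ HasHole 6 S) {x y : Plane}
    (hx : x ∈ interiorPoints S T) (hy : y ∈ interiorPoints S T) (hxy : x ≠ y)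
    (hI : ∀ i ∈ interiorPoints S T, 0 ≤ orient x y i) : (beyond T x y).card ≤ 3 := by
  classical
  by_contra hcon
  apply hno
  refine h.hasHole_six (J := {x, y}) (A := beyond T x y) ?_ (fun t ht => (mem_beyond.1 ht).1) ?_ ?_ ?_
  · simp [Finset.insert_subset_iff, hx, hy]
  · rw [Finset.card_pair hxy]; norm_num
  · rw [Finset.card_pair hxy]; omega
  · intro i hi
    refine ⟨y, (mem_interiorPoints.1 hy).1, x, (mem_interiorPoints.1 hx).1, hxy.symm, ?_, ?_, ?_⟩
    · rw [orient_swap]; linarith [hI i hi]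
    · simp
    · intro t ht
      rw [orient_swap]; linarith [(mem_beyond.1 ht).2]

theorem hasHole_of_card_eq_zero (h : IsConvexPolygon S T) (h8 : T.card = 8)
    (hI : (interiorPoints S T).card = 0) : HasHole 6 S := by
  refine h.hasHole_six (J := ∅) (A := T) (by simp) subset_rfl (by simp) (by simp [h8]) ?_
  rw [Finset.card_eq_zero] at hI
  simp [hI]

/-- The line through the interior point `y` and a vertex `v` has at least four of the other seven
vertices on one side; these, `v` and `y` form the hole. -/
theorem hasHole_of_card_eq_one (h : IsConvexPolygon S T) (h8 : T.card = 8)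
    (hI : (interiorPoints S T).card = 1) : HasHole 6 S := by
  classical
  obtain ⟨y, hy⟩ := Finset.card_eq_one.1 hI
  have hyI : y ∈ interiorPoints S T := by simp [hy]
  obtain ⟨v, hv⟩ : T.Nonempty := by rw [← Finset.card_pos]; omega
  have hvy := h.ne_of_mem hv hyI
  have hyS := (mem_interiorPoints.1 hyI).1
  have key : ∀ p q : Plane, p ∈ S → q ∈ S → p ≠ q → orient p q y = 0 → orient p q v = 0 →
      4 ≤ ((T.erase v).filter (fun t => 0 < orient p q t)).card → HasHole 6 S := by
    intro p q hp hq hpq h1 h2 h3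
    refine h.hasHole_six (J := {y}) (A := insert v ((T.erase v).filter (fun t => 0 < orient p q t)))
      (by simp [hyI]) ?_ (by simp) ?_ ?_
    · intro t ht
      simp only [Finset.mem_insert, Finset.mem_filter, Finset.mem_erase] at ht
      rcases ht with rfl | ht
      · exact hv
      · exact ht.1.2
    · rw [Finset.card_insert_of_notMem (by simp)]
      simp only [Finset.card_singleton]; omega
    · intro x hx
      rw [hy, Finset.mem_singleton] at hx
      subst hx
      refine ⟨p, hp, q, hq, hpq, h1.le, by simp [h1], ?_⟩
      intro t ht
      simp only [Finset.mem_insert, Finset.mem_filter] at ht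
      rcases ht with rfl | ht
      · exact h2.ge
      · exact ht.2.le
  by_cases h4 : 4 ≤ ((T.erase v).filter (fun t => 0 < orient y v t)).card
  · exact key y v hyS (h.subset hv) hvy.symm (by simp) (by simp) h4
  · refine key v y (h.subset hv) hyS hvy (by simp) (by simp) ?_
    have hsum := Finset.card_filter_add_card_filter_not (s := T.erase v) (fun t => 0 < orient y v t)
    rw [Finset.card_erase_of_mem hv, h8] at hsum
    have hsub : (T.erase v).filter (fun t => ¬ 0 < orient y v t) ⊆
        (T.erase v).filter (fun t => 0 < orient v y t) := by
      intro t ht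
      simp only [Finset.mem_filter, Finset.mem_erase] at ht ⊢
      refine ⟨ht.1, ?_⟩
      have := h.generalPosition.orient_ne_zero hyS (h.subset hv) (h.subset ht.1.2) hvy.symm
        ht.1.1.symm (h.ne_of_mem ht.1.2 hyI).symm
      rw [orient_swap]
      have h2 := lt_of_le_of_ne (not_lt.1 ht.2) this
      linarith
    have := Finset.card_le_card hsub
    omega

theorem hasHole_of_card_eq_two (h : IsConvexPolygon S T) (h8 : T.card = 8)
    (hI : (interiorPoints S T).card = 2) : HasHole 6 S := by
  classical
  by_contra hno
  obtain ⟨x, y, hxy, hI⟩ := Finset.card_eq_two.1 hI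
  have hx : x ∈ interiorPoints S T := by simp [hI]
  have hy : y ∈ interiorPoints S T := by simp [hI]
  have h1 := h.card_beyond_le hno hx hy hxy (by simp [hI])
  have h2 := h.card_beyond_le hno hy hx hxy.symm (by simp [hI])
  have hsub : T ⊆ beyond T x y ∪ beyond T y x := by
    intro t ht
    rw [Finset.mem_union, mem_beyond, mem_beyond, orient_swap x y]
    rcases lt_or_gt_of_ne (h.orient_ne_zero ht hx hy hxy) with h1 | h1
    · exact Or.inl ⟨ht, h1⟩
    · exact Or.inr ⟨ht, by linarith⟩
  have := (Finset.card_le_card hsub).trans (Finset.card_union_le _ _)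
  omega

/-- A triangle of interior points, with at most one more interior point `w`, inside it, and three
vertices that see only its edge `z x`. -/
theorem hasHole_of_triangle (h : IsConvexPolygon S T) {x y z w : Plane}
    (hx : x ∈ interiorPoints S T) (hy : y ∈ interiorPoints S T) (hz : z ∈ interiorPoints S T)
    (hw : w ∈ interiorPoints S T) (hI : ∀ i ∈ interiorPoints S T, i = x ∨ i = y ∨ i = z ∨ i = w)
    (hxyz : 0 < orient x y z) (hwy : w = y ∨ InTri x y z w)
    (hA : 8 ≤ T.card) (hB : (open Classical in beyond T x y ∪ beyond T y z).card ≤ 5) :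
    HasHole 6 S := by
  classical
  have hxy : x ≠ y := by rintro rfl; simp at hxyz
  have hyz : y ≠ z := by rintro rfl; simp at hxyz
  have hxz : x ≠ z := by rintro rfl; simp at hxyz
  -- The hole consists of `x`, `w`, `z` and three vertices beyond neither `x y` nor `y z`. The case
  -- `w = y` encodes that there is no fourth interior point.
  have h1 : 0 < orient x w z := by
    rcases hwy with rfl | hin
    · exact hxyz
    · rw [orient_rotate]; exact hin.2.2
  have hxw : x ≠ w := by rintro rfl; simp at h1
  have hwz : w ≠ z := by rintro rfl; simp at h1
  have hsee : ∀ a ∈ T \ (beyond T x y ∪ beyond T y z), 0 ≤ orient x w a ∧ 0 ≤ orient w z a := by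
    intro a ha
    simp only [Finset.mem_sdiff, Finset.mem_union, not_or] at ha
    have ha1 := h.pos_of_notMem_beyond ha.1 hx hy hxy ha.2.1
    have ha2 := h.pos_of_notMem_beyond ha.1 hy hz hyz ha.2.2
    rcases hwy with rfl | hin
    · exact ⟨ha1.le, ha2.le⟩
    -- A vertex left of `x y` and of `y z` must be right of `z x`, since it is not inside the
    -- triangle. As `w` is inside, such a vertex is also left of `x w` and of `w z`.
    · have ha3 : orient z x a ≤ 0 := by
        by_contra hcon
        exact h.not_inTri ha.1 hx hy hz ⟨ha1, ha2, not_le.1 hcon⟩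
      obtain ⟨w1, w2, w3⟩ := hin
      constructor
      · have e : orient x w a * orient x y z =
            orient z x w * orient x y a - orient x y w * orient z x a := by
          unfold orient; ring
        have : 0 ≤ orient x w a * orient x y z := by
          rw [e]; nlinarith [mul_pos w3 ha1, mul_nonneg w1.le (neg_nonneg.2 ha3)]
        exact nonneg_of_mul_nonneg_left this hxyz
      · have e : orient w z a * orient x y z =
            orient z x w * orient y z a - orient y z w * orient z x a := by
          unfold orient; ring
        have : 0 ≤ orient w z a * orient x y z := by
          rw [e]; nlinarith [mul_pos w3 ha2, mul_nonneg w2.le (neg_nonneg.2 ha3)]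
        exact nonneg_of_mul_nonneg_left this hxyz
  have hcard : ({x, w, z} : Finset Plane).card = 3 := by
    rw [Finset.card_eq_three]; exact ⟨x, w, z, hxw, hxz, hwz, rfl⟩
  refine h.hasHole_six (J := {x, w, z}) (A := T \ (beyond T x y ∪ beyond T y z)) ?_
    Finset.sdiff_subset (by omega) ?_ ?_
  · simp [Finset.insert_subset_iff, hx, hz, hw]
  · have := Finset.le_card_sdiff (beyond T x y ∪ beyond T y z) T
    omega
  · intro i hi
    have hS : ∀ {u}, u ∈ interiorPoints S T → u ∈ S := fun hu => (mem_interiorPoints.1 hu).1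
    -- The line `x w` separates off `x`, `y` and `w`; only `z` needs the line `w z`.
    by_cases hiz : i = z
    · subst hiz
      refine ⟨w, hS hw, i, hS hz, hwz, by simp, ?_, fun t ht => (hsee t ht).2⟩
      have h2 : orient w i x = orient x w i := orient_rotate x w i
      simp [h2, h1.le]
    · refine ⟨x, hS hx, w, hS hw, hxw, ?_, ?_, fun t ht => (hsee t ht).1⟩
      · rcases hI i hi with rfl | rfl | rfl | rfl
        · simp
        · rcases hwy with rfl | hin
          · simp
          · rw [orient_swap_right]; linarith [hin.1]
        · exact absurd rfl hiz
        · simp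
      · simp [h1.le]

/-- If all three pairwise unions had six elements, the sets would be disjoint triples, with nine
elements in all. -/
theorem _root_.Finset.card_union_le_five {α : Type*} [DecidableEq α] {A B C : Finset α}
    (hA : A.card ≤ 3) (hB : B.card ≤ 3) (hC : C.card ≤ 3) (h : (A ∪ B ∪ C).card ≤ 8) :
    (A ∪ B).card ≤ 5 ∨ (B ∪ C).card ≤ 5 ∨ (C ∪ A).card ≤ 5 := by
  by_contra hcon
  push Not at hcon
  obtain ⟨h1, h2, h3⟩ := hcon
  have a1 := Finset.card_union_add_card_inter A B
  have a2 := Finset.card_union_add_card_inter B C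
  have a3 := Finset.card_union_add_card_inter C A
  have a4 := Finset.card_union_add_card_inter (A ∪ B) C
  have a5 : ((A ∪ B) ∩ C).card ≤ (C ∩ A).card + (B ∩ C).card := by
    rw [Finset.union_inter_distrib_right, Finset.inter_comm A C]
    exact Finset.card_union_le _ _
  omega

/-- At most three vertices lie beyond each edge of the triangle, so by counting some two edges
together have at most five beyond them. The other three vertices or more see only the third edge. -/
theorem hasHole_of_triangle_hull (h : IsConvexPolygon S T) (h8 : T.card = 8) {x y z : Plane}
    (hx : x ∈ interiorPoints S T) (hy : y ∈ interiorPoints S T) (hz : z ∈ interiorPoints S T)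
    (hxyz : 0 < orient x y z) (hI : (∀ i ∈ interiorPoints S T, i = x ∨ i = y ∨ i = z) ∨
      ∃ w ∈ interiorPoints S T, InTri x y z w ∧
        ∀ i ∈ interiorPoints S T, i = x ∨ i = y ∨ i = z ∨ i = w) :
    HasHole 6 S := by
  classical
  by_contra hno
  have hxy : x ≠ y := by rintro rfl; simp at hxyz
  have hyz : y ≠ z := by rintro rfl; simp at hxyz
  have hzx : z ≠ x := by rintro rfl; simp at hxyz
  have hyzx : 0 < orient y z x := by rwa [orient_rotate]
  have hzxy : 0 < orient z x y := by rwa [← orient_rotate]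
  have hin : ∀ i ∈ interiorPoints S T, 0 ≤ orient x y i ∧ 0 ≤ orient y z i ∧ 0 ≤ orient z x i := by
    intro i hi
    rcases hI with hI | ⟨w, _, hw, hI⟩
    · rcases hI i hi with rfl | rfl | rfl <;> simp [hxyz.le, hyzx.le, hzxy.le]
    · rcases hI i hi with rfl | rfl | rfl | rfl
      · simp [hyzx.le]
      · simp [hzxy.le]
      · simp [hxyz.le]
      · exact ⟨hw.1.le, hw.2.1.le, hw.2.2.le⟩
  have b1 := h.card_beyond_le hno hx hy hxy (fun i hi => (hin i hi).1)
  have b2 := h.card_beyond_le hno hy hz hyz (fun i hi => (hin i hi).2.1)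
  have b3 := h.card_beyond_le hno hz hx hzx (fun i hi => (hin i hi).2.2)
  have hsub : beyond T x y ∪ beyond T y z ∪ beyond T z x ⊆ T := by
    intro t ht
    simp only [Finset.mem_union, mem_beyond] at ht
    tauto
  have hu := Finset.card_le_card hsub
  rw [h8] at hu
  have fin : ∀ {x y z : Plane}, x ∈ interiorPoints S T → y ∈ interiorPoints S T →
      z ∈ interiorPoints S T → 0 < orient x y z →
      ((∀ i ∈ interiorPoints S T, i = x ∨ i = y ∨ i = z) ∨
      ∃ w ∈ interiorPoints S T, InTri x y z w ∧
        ∀ i ∈ interiorPoints S T, i = x ∨ i = y ∨ i = z ∨ i = w) →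
      (beyond T x y ∪ beyond T y z).card ≤ 5 → False := by
    intro x y z hx hy hz hxyz hI hB
    rcases hI with hI | ⟨w, hw, hin, hI⟩
    · exact hno (h.hasHole_of_triangle hx hy hz hy (fun i hi => by have := hI i hi; tauto) hxyz
        (Or.inl rfl) h8.ge hB)
    · exact hno (h.hasHole_of_triangle hx hy hz hw hI hxyz (Or.inr hin) h8.ge hB)
  rcases Finset.card_union_le_five b1 b2 b3 hu with hB | hB | hB
  · exact fin hx hy hz hxyz hI hB
  · refine fin hy hz hx hyzx ?_ hB
    rcases hI with hI | ⟨w, hw, hin, hI⟩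
    · exact Or.inl fun i hi => by have := hI i hi; tauto
    · exact Or.inr ⟨w, hw, hin.rotate, fun i hi => by have := hI i hi; tauto⟩
  · refine fin hz hx hy hzxy ?_ hB
    rcases hI with hI | ⟨w, hw, hin, hI⟩
    · exact Or.inl fun i hi => by have := hI i hi; tauto
    · exact Or.inr ⟨w, hw, hin.rotate.rotate, fun i hi => by have := hI i hi; tauto⟩

theorem hasHole_of_card_eq_three (h : IsConvexPolygon S T) (h8 : T.card = 8)
    (hI : (interiorPoints S T).card = 3) : HasHole 6 S := by
  classical
  obtain ⟨x, y, z, hxy, hxz, hyz, hI⟩ := Finset.card_eq_three.1 hI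
  have hx : x ∈ interiorPoints S T := by simp [hI]
  have hy : y ∈ interiorPoints S T := by simp [hI]
  have hz : z ∈ interiorPoints S T := by simp [hI]
  have hne := h.generalPosition.orient_ne_zero (mem_interiorPoints.1 hx).1
    (mem_interiorPoints.1 hy).1 (mem_interiorPoints.1 hz).1 hxy hyz hxz
  rcases lt_or_gt_of_ne hne with h1 | h1
  · refine h.hasHole_of_triangle_hull h8 hy hx hz (by rw [orient_swap]; linarith) (Or.inl ?_)
    intro i hi
    simp only [hI, Finset.mem_insert, Finset.mem_singleton] at hi
    tauto
  · refine h.hasHole_of_triangle_hull h8 hx hy hz h1 (Or.inl ?_)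
    intro i hi
    simpa [hI] using hi

/-- At most three vertices lie beyond each of the opposite edges `q r` and `s p`. So at least two
vertices lie beyond neither, and they complete `p`, `q`, `r`, `s` to a hole supported by these two
lines. -/
theorem hasHole_of_quadrilateral (h : IsConvexPolygon S T) (h8 : T.card = 8) {p q r s : Plane}
    (hp : p ∈ interiorPoints S T) (hq : q ∈ interiorPoints S T) (hr : r ∈ interiorPoints S T)
    (hs : s ∈ interiorPoints S T)
    (hI : ∀ i ∈ interiorPoints S T, i = p ∨ i = q ∨ i = r ∨ i = s)
    (h1 : 0 < orient p q r) (h2 : 0 < orient q r s) (h3 : 0 < orient r s p)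
    (h4 : 0 < orient s p q) : HasHole 6 S := by
  classical
  by_contra hno
  have hpq : p ≠ q := by rintro rfl; simp at h1
  have hqr : q ≠ r := by rintro rfl; simp at h1
  have hpr : p ≠ r := by rintro rfl; simp at h1
  have hrs : r ≠ s := by rintro rfl; simp at h2
  have hqs : q ≠ s := by rintro rfl; simp at h2
  have hps : p ≠ s := by rintro rfl; simp at h3
  have e1 : 0 < orient q r p := by rwa [orient_rotate]
  have e2 : 0 < orient s p r := by rwa [orient_rotate]
  have hS : ∀ {u}, u ∈ interiorPoints S T → u ∈ S := fun hu => (mem_interiorPoints.1 hu).1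
  have b1 := h.card_beyond_le hno hq hr hqr (fun i hi => by
    rcases hI i hi with rfl | rfl | rfl | rfl <;> simp [h2.le, e1.le])
  have b2 := h.card_beyond_le hno hs hp hps.symm (fun i hi => by
    rcases hI i hi with rfl | rfl | rfl | rfl <;> simp [h4.le, e2.le])
  have hcard : ({p, q, r, s} : Finset Plane).card = 4 := by
    rw [Finset.card_insert_of_notMem (by simp [hpq, hpr, hps]), Finset.card_eq_three.2
      ⟨q, r, s, hqr, hqs, hrs, rfl⟩]
  have hsee : ∀ a ∈ T \ (beyond T q r ∪ beyond T s p), 0 ≤ orient q r a ∧ 0 ≤ orient s p a := by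
    intro a ha
    simp only [Finset.mem_sdiff, Finset.mem_union, not_or] at ha
    exact ⟨(h.pos_of_notMem_beyond ha.1 hq hr hqr ha.2.1).le,
      (h.pos_of_notMem_beyond ha.1 hs hp hps.symm ha.2.2).le⟩
  apply hno
  refine h.hasHole_six (J := {p, q, r, s}) (A := T \ (beyond T q r ∪ beyond T s p)) ?_
    Finset.sdiff_subset (by omega) ?_ ?_
  · simp [Finset.insert_subset_iff, hp, hq, hr, hs]
  · have := Finset.le_card_sdiff (beyond T q r ∪ beyond T s p) T
    have := Finset.card_union_le (beyond T q r) (beyond T s p)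
    omega
  · intro i hi
    have c1 : ∀ t ∈ ({p, q, r, s} : Finset Plane), 0 ≤ orient q r t := by
      simp [e1.le, h2.le]
    have c2 : ∀ t ∈ ({p, q, r, s} : Finset Plane), 0 ≤ orient s p t := by
      simp [e2.le, h4.le]
    rcases hI i hi with rfl | rfl | rfl | rfl
    · exact ⟨s, hS hs, i, hS hi, hps.symm, by simp, c2, fun t ht => (hsee t ht).2⟩
    · exact ⟨i, hS hi, r, hS hr, hqr, by simp, c1, fun t ht => (hsee t ht).1⟩
    · exact ⟨q, hS hq, i, hS hi, hqr, by simp, c1, fun t ht => (hsee t ht).1⟩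
    · exact ⟨i, hS hi, p, hS hp, hps.symm, by simp, c2, fun t ht => (hsee t ht).2⟩

/-- The signs of `d` against the edges of `a b c` decide. With no negative sign `d` is inside the
triangle, with one the four points are in convex position, and with two one of `a`, `b`, `c` is
inside the triangle of the others; three are impossible. -/
theorem hasHole_of_four (h : IsConvexPolygon S T) (h8 : T.card = 8) {a b c d : Plane}
    (ha : a ∈ interiorPoints S T) (hb : b ∈ interiorPoints S T) (hc : c ∈ interiorPoints S T)
    (hd : d ∈ interiorPoints S T)
    (hall : ∀ i ∈ interiorPoints S T, i = a ∨ i = b ∨ i = c ∨ i = d)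
    (had : a ≠ d) (hbd : b ≠ d) (hcd : c ≠ d) (hpos : 0 < orient a b c) : HasHole 6 S := by
  have hS : ∀ {u}, u ∈ interiorPoints S T → u ∈ S := fun hu => (mem_interiorPoints.1 hu).1
  have hab : a ≠ b := by rintro rfl; simp at hpos
  have hbc : b ≠ c := by rintro rfl; simp at hpos
  have hac : a ≠ c := by rintro rfl; simp at hpos
  have n1 := h.generalPosition.orient_ne_zero (hS ha) (hS hb) (hS hd) hab hbd had
  have n2 := h.generalPosition.orient_ne_zero (hS hb) (hS hc) (hS hd) hbc hcd hbd
  have n3 := h.generalPosition.orient_ne_zero (hS hc) (hS ha) (hS hd) hac.symm had hcd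
  have hsum : orient a b c = orient a b d + orient b c d + orient c a d := by
    unfold orient; ring
  have tri : ∀ x y z w : Plane, x ∈ interiorPoints S T → y ∈ interiorPoints S T →
      z ∈ interiorPoints S T → w ∈ interiorPoints S T → InTri x y z w →
      (∀ i ∈ interiorPoints S T, i = x ∨ i = y ∨ i = z ∨ i = w) → HasHole 6 S :=
    fun x y z w hx hy hz hw hin hi =>
      h.hasHole_of_triangle_hull h8 hx hy hz hin.orient_pos (Or.inr ⟨w, hw, hin, hi⟩)
  have adb : orient a d b = -orient a b d := by unfold orient; ring
  have dba : orient d b a = -orient a b d := by unfold orient; ring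
  have dab : orient d a b = orient a b d := by unfold orient; ring
  have dcb : orient d c b = -orient b c d := by unfold orient; ring
  have bdc : orient b d c = -orient b c d := by unfold orient; ring
  have dbc : orient d b c = orient b c d := by unfold orient; ring
  have cda : orient c d a = -orient c a d := by unfold orient; ring
  have dac : orient d a c = -orient c a d := by unfold orient; ring
  have dca : orient d c a = orient c a d := by unfold orient; ring
  have cab : 0 < orient c a b := by rwa [orient_rotate, orient_rotate]
  have bca : 0 < orient b c a := by rwa [orient_rotate]
  rcases lt_or_gt_of_ne n1 with m1 | m1 <;> rcases lt_or_gt_of_ne n2 with m2 | m2 <;>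
    rcases lt_or_gt_of_ne n3 with m3 | m3
  · linarith
  · refine tri a d c b ha hd hc hb ⟨?_, ?_, cab⟩ (fun i hi => by have := hall i hi; tauto)
    · rw [adb]; exact neg_pos.2 m1
    · rw [dcb]; exact neg_pos.2 m2
  · refine tri c d b a hc hd hb ha ⟨?_, ?_, bca⟩ (fun i hi => by have := hall i hi; tauto)
    · rw [cda]; exact neg_pos.2 m3
    · rw [dba]; exact neg_pos.2 m1
  · refine h.hasHole_of_quadrilateral h8 ha hd hb hc (fun i hi => by have := hall i hi; tauto)
      ?_ ?_ bca m3
    · rw [adb]; exact neg_pos.2 m1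
    · rwa [dbc]
  · refine tri b d a c hb hd ha hc ⟨?_, ?_, hpos⟩ (fun i hi => by have := hall i hi; tauto)
    · rw [bdc]; exact neg_pos.2 m2
    · rw [dac]; exact neg_pos.2 m3
  · refine h.hasHole_of_quadrilateral h8 hb hd hc ha (fun i hi => by have := hall i hi; tauto)
      ?_ ?_ cab m1
    · rw [bdc]; exact neg_pos.2 m2
    · rwa [dca]
  · refine h.hasHole_of_quadrilateral h8 hc hd ha hb (fun i hi => by have := hall i hi; tauto)
      ?_ ?_ hpos m2
    · rw [cda]; exact neg_pos.2 m3
    · rwa [dab]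
  · exact tri a b c d ha hb hc hd ⟨m1, m2, m3⟩ hall

theorem hasHole_of_card_eq_four (h : IsConvexPolygon S T) (h8 : T.card = 8)
    (hI : (interiorPoints S T).card = 4) : HasHole 6 S := by
  classical
  obtain ⟨a, I', haI', hI', h3⟩ := Finset.card_eq_succ.1 hI
  obtain ⟨b, c, d, hbc, hbd, hcd, rfl⟩ := Finset.card_eq_three.1 h3
  simp only [Finset.mem_insert, Finset.mem_singleton, not_or] at haI'
  obtain ⟨hab, hac, had⟩ := haI'
  have ha : a ∈ interiorPoints S T := by simp [← hI']
  have hb : b ∈ interiorPoints S T := by simp [← hI']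
  have hc : c ∈ interiorPoints S T := by simp [← hI']
  have hd : d ∈ interiorPoints S T := by simp [← hI']
  have hall : ∀ i ∈ interiorPoints S T, i = a ∨ i = b ∨ i = c ∨ i = d := by
    intro i hi
    simpa [← hI'] using hi
  have hne := h.generalPosition.orient_ne_zero (mem_interiorPoints.1 ha).1
    (mem_interiorPoints.1 hb).1 (mem_interiorPoints.1 hc).1 hab hbc hac
  rcases lt_or_gt_of_ne hne with h1 | h1
  · refine h.hasHole_of_four h8 hb ha hc hd (fun i hi => ?_) hbd had hcd
      (by rw [orient_swap]; linarith)
    have := hall i hi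
    tauto
  · exact h.hasHole_of_four h8 ha hb hc hd hall had hbd hcd h1

theorem hasHole_of_card_le_four (h : IsConvexPolygon S T) (h8 : T.card = 8)
    (hI : (interiorPoints S T).card ≤ 4) : HasHole 6 S := by
  interval_cases hc : (interiorPoints S T).card
  · exact h.hasHole_of_card_eq_zero h8 hc
  · exact h.hasHole_of_card_eq_one h8 hc
  · exact h.hasHole_of_card_eq_two h8 hc
  · exact h.hasHole_of_card_eq_three h8 hc
  · exact h.hasHole_of_card_eq_four h8 hc

end IsConvexPolygon

/-! ### Cyclic order of the vertices, and octagons with the fewest interior points. -/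

namespace IsConvexPolygon

variable {S T : Finset Plane}

theorem not_inTri_vertices (h : IsConvexPolygon S T) {t a b c : Plane} (ht : t ∈ T)
    (ha : a ∈ T) (hb : b ∈ T) (hc : c ∈ T) : ¬ InTri a b c t := fun hin =>
  not_mem_interior_of_mem_extremePoints
    (mem_extremePoints_of_convexIndependent h.convexIndependent ht)
    (hin.mem_interior_convexHull (subset_convexHull ℝ _ ha) (subset_convexHull ℝ _ hb)
      (subset_convexHull ℝ _ hc))

theorem orient_vertices_ne_zero (h : IsConvexPolygon S T) {a b c : Plane} (ha : a ∈ T)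
    (hb : b ∈ T) (hc : c ∈ T) (hab : a ≠ b) (hbc : b ≠ c) (hac : a ≠ c) : orient a b c ≠ 0 :=
  h.generalPosition.orient_ne_zero (h.subset ha) (h.subset hb) (h.subset hc) hab hbc hac

/-- Otherwise `a`, `b`, `c` would wind around `o`, which would lie inside their triangle. -/
theorem orient_trans (h : IsConvexPolygon S T) {o a b c : Plane} (ho : o ∈ T) (ha : a ∈ T)
    (hb : b ∈ T) (hc : c ∈ T) (hao : a ≠ o) (hco : c ≠ o) (h1 : 0 < orient o a b)
    (h2 : 0 < orient o b c) : 0 < orient o a c := by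
  by_contra hcon
  have hac : a ≠ c := by
    rintro rfl
    rw [orient_swap_right] at h2
    linarith
  have hlt := lt_of_le_of_ne (not_lt.1 hcon)
    (h.orient_vertices_ne_zero ho ha hc hao.symm hac hco.symm)
  refine h.not_inTri_vertices ho ha hb hc ⟨?_, ?_, ?_⟩
  · rwa [orient_rotate]
  · rwa [orient_rotate]
  · rw [orient_rotate, orient_swap_right]; linarith

/-- The vertices of a convex polygon can be enumerated in counterclockwise order. -/
theorem exists_ccw_enumeration (h : IsConvexPolygon S T) (hne : T.Nonempty) :
    ∃ w : ℕ → Plane, (∀ t, t ∈ T ↔ ∃ i < T.card, w i = t) ∧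
      ∀ i j l, i < j → j < l → l < T.card → 0 < orient (w i) (w j) (w l) := by
  classical
  obtain ⟨o, ho⟩ := hne
  -- The other vertices are sorted by angle about one vertex `o`; `orient_trans` makes this a strict
  -- total order.
  let α := {x // x ∈ T.erase o}
  let r : α → α → Prop := fun a b => 0 < orient o a b
  have mem : ∀ a : α, (a : Plane) ∈ T ∧ (a : Plane) ≠ o := fun a =>
    ⟨Finset.mem_of_mem_erase a.2, Finset.ne_of_mem_erase a.2⟩
  have hst : IsStrictTotalOrder α r :=
    { trichotomous := by
        intro a b hab hba
        by_contra hne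
        have := h.orient_vertices_ne_zero ho (mem a).1 (mem b).1 (mem a).2.symm
          (fun e => hne (Subtype.ext e)) (mem b).2.symm
        rcases lt_or_gt_of_ne this with h1 | h1
        · exact hba (by show 0 < orient o b a; rw [orient_swap_right]; linarith)
        · exact hab h1
      irrefl := by
        intro a ha
        have : 0 < orient o a a := ha
        simp at this
      trans := fun a b c hab hbc =>
        h.orient_trans ho (mem a).1 (mem b).1 (mem c).1 (mem a).2 (mem c).2 hab hbc }
  let : LinearOrder α := linearOrderOfSTO r
  have hlt : ∀ a b : α, a < b → 0 < orient o a b := fun a b hab => hab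
  have hcard : Fintype.card α = T.card - 1 := by
    rw [Fintype.card_coe, Finset.card_erase_of_mem ho]
  have hpos : 0 < T.card := Finset.card_pos.2 ⟨o, ho⟩
  let e := monoEquivOfFin α hcard
  -- Index 0 is `o`, the sorted vertices start at index 1, and out-of-range indices default to `o`,
  -- so that `w i ∈ T` holds for every `i`.
  let w : ℕ → Plane := fun i => if hi : 0 < i ∧ i < T.card then
    (e ⟨i - 1, by omega⟩ : Plane) else o
  have w0 : w 0 = o := by simp [w]
  have wmem : ∀ i, w i ∈ T := by
    intro i
    by_cases hi : 0 < i ∧ i < T.card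
    · simp only [w, hi, and_self, dif_pos]
      exact (mem _).1
    · simp only [w, hi, dif_neg, not_false_eq_true]
      exact ho
  have wne : ∀ i, 0 < i → i < T.card → w i ≠ o := by
    intro i h1 h2
    have hi : 0 < i ∧ i < T.card := ⟨h1, h2⟩
    simp only [w, hi, and_self, dif_pos]
    exact (mem _).2
  have wlt : ∀ i j, 0 < i → i < j → j < T.card → 0 < orient o (w i) (w j) := by
    intro i j h1 h2 h3
    have hi : 0 < i ∧ i < T.card := ⟨h1, h2.trans h3⟩
    have hj : 0 < j ∧ j < T.card := ⟨h1.trans h2, h3⟩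
    simp only [w, hi, hj, and_self, dif_pos]
    apply hlt
    rw [e.lt_iff_lt, Fin.mk_lt_mk]
    omega
  refine ⟨w, fun t => ⟨fun ht => ?_, ?_⟩, ?_⟩
  · by_cases hto : t = o
    · exact ⟨0, hpos, by rw [w0, hto]⟩
    · let a : α := ⟨t, Finset.mem_erase.2 ⟨hto, ht⟩⟩
      have hlt' := (e.symm a).2
      have hi : 0 < (e.symm a : ℕ) + 1 ∧ (e.symm a : ℕ) + 1 < T.card := by omega
      refine ⟨(e.symm a : ℕ) + 1, hi.2, ?_⟩
      simp only [w, hi, and_self, dif_pos, Nat.add_sub_cancel, Fin.eta, OrderIso.apply_symm_apply]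
      rfl
  · rintro ⟨i, _, rfl⟩
    exact wmem i
  · intro i j l hij hjl hl
    rcases Nat.eq_zero_or_pos i with rfl | hi
    · rw [w0]; exact wlt j l hij hjl hl
    have h1 := wlt i j hi hij (hjl.trans hl)
    have h2 := wlt j l (hi.trans hij) hjl hl
    have h3 := wlt i l hi (hij.trans hjl) hl
    by_contra hcon
    have hlt := lt_of_le_of_ne (not_lt.1 hcon) (h.orient_vertices_ne_zero (wmem i) (wmem j) (wmem l)
      (by intro e; rw [e] at h1; simp at h1) (by intro e; rw [e] at h2; simp at h2)
      (by intro e; rw [e] at h3; simp at h3))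
    refine h.not_inTri_vertices (wmem j) ho (wmem i) (wmem l) ⟨h1, ?_, ?_⟩
    · rw [orient_swap_right]; linarith
    · rw [← orient_rotate]; exact h2

/-- Replace `t` by `x`. The line `p q` shows that `x` is a vertex of the new polygon, which lies in
the old hull and no longer has `x` in its interior. -/
theorem exists_fewer_interiorPoints (h : IsConvexPolygon S T) {t x p q : Plane} (ht : t ∈ T)
    (hx : x ∈ interiorPoints S T) (hpq : p ≠ q) (hlt : orient p q x < 0)
    (hall : ∀ u ∈ T, u ≠ t → 0 ≤ orient p q u) :
    ∃ T', IsConvexPolygon S T' ∧ T'.card = T.card ∧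
      (interiorPoints S T').card < (interiorPoints S T).card := by
  classical
  have hxT : x ∉ T := fun hxT => h.ne_of_mem hxT hx rfl
  have hsub : ((insert x (T.erase t) : Finset Plane) : Set Plane) ⊆ convexHull ℝ (T : Set Plane) := by
    intro u hu
    rcases Finset.mem_insert.1 (Finset.mem_coe.1 hu) with rfl | hu
    · exact interior_subset (mem_interiorPoints.1 hx).2
    · exact subset_convexHull ℝ _ (Finset.mem_of_mem_erase hu)
  refine ⟨insert x (T.erase t), ⟨h.generalPosition, ?_, ?_⟩, ?_, ?_⟩
  · intro u hu
    rcases Finset.mem_insert.1 hu with rfl | hu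
    · exact (mem_interiorPoints.1 hx).1
    · exact h.subset (Finset.mem_of_mem_erase hu)
  · refine (convexIndependent_set_iff_notMem_convexHull_sdiff
      (s := ((insert x (T.erase t) : Finset Plane) : Set Plane))).2 fun u hu => ?_
    rcases Finset.mem_insert.1 (Finset.mem_coe.1 hu) with rfl | hu
    · intro hmem
      refine absurd (orient_nonneg_of_mem_convexHull (a := p) (b := q) (r := 0) ?_ hmem)
        (not_le.2 hlt)
      rintro s ⟨hs, hsu⟩
      rcases Finset.mem_insert.1 (Finset.mem_coe.1 hs) with rfl | hs
      · exact absurd rfl hsu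
      · exact hall s (Finset.mem_of_mem_erase hs) (Finset.ne_of_mem_erase hs)
    · exact notMem_convexHull_sdiff_of_mem_extremePoints (convex_convexHull ℝ _) hsub
        (mem_extremePoints_of_convexIndependent h.convexIndependent (Finset.mem_of_mem_erase hu))
  · rw [Finset.card_insert_of_notMem (fun hm => hxT (Finset.mem_of_mem_erase hm)),
      Finset.card_erase_of_mem ht]
    have : 0 < T.card := Finset.card_pos.2 ⟨t, ht⟩
    omega
  · apply Finset.card_lt_card
    rw [Finset.ssubset_iff_of_subset]
    · refine ⟨x, hx, fun hm => not_mem_interior_convexHull hpq ?_ (mem_interiorPoints.1 hm).2⟩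
      intro u hu
      rcases Finset.mem_insert.1 (Finset.mem_coe.1 hu) with rfl | hu
      · exact le_rfl
      · exact hlt.le.trans (hall u (Finset.mem_of_mem_erase hu) (Finset.ne_of_mem_erase hu))
    · intro u hu
      rw [mem_interiorPoints] at hu ⊢
      exact ⟨hu.1, interior_mono (convexHull_min hsub (convex_convexHull ℝ _)) hu.2⟩

end IsConvexPolygon

open Classical in
/-- The points of `S` in the interior of the counterclockwise triangle `a b c`. -/
noncomputable def triPoints (S : Finset Plane) (a b c : Plane) : Finset Plane :=
  S.filter (InTri a b c)

theorem mem_triPoints {S : Finset Plane} {a b c x : Plane} :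
    x ∈ triPoints S a b c ↔ x ∈ S ∧ InTri a b c x := by
  simp [triPoints]

namespace IsConvexPolygon

variable {S T : Finset Plane}

/-- An octagon with few points in each triangle and with the least number of interior points has at
most four interior points. -/
theorem card_interiorPoints_le_four (h : IsConvexPolygon S T) (h8 : T.card = 8)
    (htri : ∀ a ∈ S, ∀ b ∈ S, ∀ c ∈ S, (triPoints S a b c).card ≤ 2)
    (hmin : ∀ T', IsConvexPolygon S T' → T'.card = 8 →
      (interiorPoints S T).card ≤ (interiorPoints S T').card) :
    (interiorPoints S T).card ≤ 4 := by
  classical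
  obtain ⟨w, hw, hpos⟩ := h.exists_ccw_enumeration (by rw [← Finset.card_pos]; omega)
  rw [h8] at hw hpos
  have wT : ∀ i, i < 8 → w i ∈ T := fun i hi => (hw _).2 ⟨i, hi, rfl⟩
  -- A point not strictly left of a diagonal that cuts off only the vertex `t` could replace `t`,
  -- against the minimality of the octagon.
  have ear : ∀ p q t : Plane, p ∈ T → q ∈ T → t ∈ T → p ≠ q →
      (∀ u ∈ T, u ≠ t → 0 ≤ orient p q u) → ∀ x ∈ interiorPoints S T, 0 < orient p q x := by
    intro p q t hp hq ht hpq hall x hx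
    by_contra hcon
    have hne := h.generalPosition.orient_ne_zero (h.subset hp) (h.subset hq)
      (mem_interiorPoints.1 hx).1 hpq (h.ne_of_mem hq hx) (h.ne_of_mem hp hx)
    obtain ⟨T', h1, h2, h3⟩ := h.exists_fewer_interiorPoints ht hx hpq
      (lt_of_le_of_ne (not_lt.1 hcon) hne) hall
    exact absurd (hmin T' h1 (h2.trans h8)) (not_le.2 h3)
  have wne : ∀ i j, i < j → j < 8 → w i ≠ w j := by
    intro i j hij hj e
    by_cases hj' : j + 1 < 8
    · have := hpos i j (j + 1) hij (by omega) hj'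
      rw [e] at this; simp at this
    · by_cases hi : 0 < i
      · have := hpos 0 i j hi hij hj
        rw [e] at this; simp at this
      · have := hpos i (i + 1) j (by omega) (by omega) hj
        rw [e] at this; simp at this
  have side : ∀ i, i + 2 < 8 → ∀ x ∈ interiorPoints S T, 0 < orient (w i) (w (i + 2)) x := by
    intro i hi
    refine ear _ _ (w (i + 1)) (wT _ (by omega)) (wT _ hi) (wT _ (by omega))
      (wne _ _ (by omega) hi) ?_
    intro u hu hne
    obtain ⟨j, hj, rfl⟩ := (hw u).1 hu
    rcases lt_trichotomy j i with h1 | rfl | h1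
    · rw [orient_rotate]; exact (hpos j i (i + 2) h1 (by omega) hi).le
    · simp
    · rcases lt_trichotomy j (i + 2) with h2 | rfl | h2
      · exact absurd (by congr 1; omega) hne
      · simp
      · exact (hpos i (i + 2) j (by omega) h2 hj).le
  have side0 : ∀ x ∈ interiorPoints S T, 0 < orient (w 6) (w 0) x := by
    refine ear _ _ (w 7) (wT _ (by omega)) (wT _ (by omega)) (wT _ (by omega))
      (wne _ _ (by omega) (by omega)).symm ?_
    intro u hu hne
    obtain ⟨j, hj, rfl⟩ := (hw u).1 hu
    rcases Nat.eq_zero_or_pos j with rfl | h1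
    · simp
    · rcases lt_trichotomy j 6 with h2 | rfl | h2
      · rw [← orient_rotate]
        exact (hpos 0 j 6 h1 h2 (by omega)).le
      · simp
      · exact absurd (by congr 1; omega) hne
  -- The interior points lie in the quadrilateral `w 0`, `w 2`, `w 4`, `w 6`, which the diagonal
  -- from `w 0` to `w 4` cuts into two triangles.
  have hsub : interiorPoints S T ⊆
      triPoints S (w 0) (w 2) (w 4) ∪ triPoints S (w 0) (w 4) (w 6) := by
    intro x hx
    have hxS := (mem_interiorPoints.1 hx).1
    have hne := h.generalPosition.orient_ne_zero (h.subset (wT 0 (by omega)))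
      (h.subset (wT 4 (by omega))) hxS (wne 0 4 (by omega) (by omega))
      (h.ne_of_mem (wT 4 (by omega)) hx) (h.ne_of_mem (wT 0 (by omega)) hx)
    rw [Finset.mem_union, mem_triPoints, mem_triPoints]
    rcases lt_or_gt_of_ne hne with h1 | h1
    · refine Or.inl ⟨hxS, side 0 (by omega) x hx, side 2 (by omega) x hx, ?_⟩
      rw [orient_swap]; linarith
    · exact Or.inr ⟨hxS, h1, side 4 (by omega) x hx, side0 x hx⟩
  have hS : ∀ i, i < 8 → w i ∈ S := fun i hi => h.subset (wT i hi)
  have c1 := htri _ (hS 0 (by omega)) _ (hS 2 (by omega)) _ (hS 4 (by omega))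
  have c2 := htri _ (hS 0 (by omega)) _ (hS 4 (by omega)) _ (hS 6 (by omega))
  have := (Finset.card_le_card hsub).trans (Finset.card_union_le _ _)
  omega

theorem hasHole_of_eight_le_card (h : IsConvexPolygon S T) (h8 : 8 ≤ T.card)
    (htri : ∀ a ∈ S, ∀ b ∈ S, ∀ c ∈ S, (triPoints S a b c).card ≤ 2) : HasHole 6 S := by
  classical
  obtain ⟨T₀, hT₀, hc⟩ := Finset.exists_subset_card_eq h8
  have h₀ : IsConvexPolygon S T₀ := ⟨h.generalPosition, hT₀.trans h.subset,
    ConvexIndependent.mono (s := (T₀ : Set Plane)) (t := (T : Set Plane)) h.convexIndependent hT₀⟩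
  obtain ⟨T₁, hT₁, hmin⟩ := Finset.exists_min_image
    (S.powerset.filter fun T' => IsConvexPolygon S T' ∧ T'.card = 8)
    (fun T' => (interiorPoints S T').card)
    ⟨T₀, Finset.mem_filter.2 ⟨Finset.mem_powerset.2 h₀.subset, h₀, hc⟩⟩
  obtain ⟨-, h₁, h₁8⟩ := Finset.mem_filter.1 hT₁
  refine h₁.hasHole_of_card_le_four h₁8 (h₁.card_interiorPoints_le_four h₁8 htri ?_)
  intro T' hT' hT'8
  exact hmin T' (Finset.mem_filter.2 ⟨Finset.mem_powerset.2 hT'.subset, hT', hT'8⟩)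

end IsConvexPolygon

/-! ### Counting points by a fan triangulation of the hull. -/

/-- The vertices of the convex hull of a finite set. -/
noncomputable def hullVertices (S : Finset Plane) : Finset Plane :=
  open Classical in S.filter (· ∈ (convexHull ℝ (S : Set Plane)).extremePoints ℝ)

theorem coe_hullVertices (S : Finset Plane) :
    (hullVertices S : Set Plane) = (convexHull ℝ (S : Set Plane)).extremePoints ℝ := by
  ext x
  simp only [hullVertices, Finset.coe_filter, Set.mem_ofPred_eq, and_iff_right_iff_imp]
  exact fun hx => extremePoints_convexHull_subset hx

theorem convexHull_hullVertices (S : Finset Plane) :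
    convexHull ℝ (hullVertices S : Set Plane) = convexHull ℝ (S : Set Plane) := by
  rw [coe_hullVertices, S.convexHull_extremePoints]

theorem isConvexPolygon_hullVertices {S : Finset Plane} (hS : InGeneralPosition S) :
    IsConvexPolygon S (hullVertices S) := by
  refine ⟨hS, by classical exact Finset.filter_subset _ _, ?_⟩
  refine (convexIndependent_set_iff_notMem_convexHull_sdiff
    (s := (hullVertices S : Set Plane))).2 fun u hu => ?_
  rw [coe_hullVertices] at hu ⊢
  exact notMem_convexHull_sdiff_of_mem_extremePoints (convex_convexHull ℝ _)
    extremePoints_subset hu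

/-- The fan from `w 0` has `T.card - 2` triangles. By general position they cover all points off the
hull vertices, with at most two points in each. -/
theorem card_le_of_card_triPoints_le {S : Finset Plane} (hS : InGeneralPosition S) (h2 : 2 ≤ S.card)
    (htri : ∀ a ∈ S, ∀ b ∈ S, ∀ c ∈ S, (triPoints S a b c).card ≤ 2) :
    S.card + 4 ≤ 3 * (hullVertices S).card := by
  classical
  have h := isConvexPolygon_hullVertices hS
  set T := hullVertices S with hT
  have hne : T.Nonempty := by
    rw [Finset.nonempty_iff_ne_empty]
    intro h0
    have := convexHull_hullVertices S
    rw [← hT, h0] at this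
    simp only [Finset.coe_empty, convexHull_empty] at this
    rw [eq_comm, convexHull_eq_empty, Finset.coe_eq_empty] at this
    simp [this] at h2
  obtain ⟨w, hw, hpos⟩ := h.exists_ccw_enumeration hne
  have hull : ∀ x ∈ S, x ∈ convexHull ℝ (T : Set Plane) := fun x hx => by
    rw [hT, convexHull_hullVertices]; exact subset_convexHull ℝ _ hx
  -- Needed because the subtractions `T.card - 2` and `T.card - 1` below are truncated.
  have hT2 : 2 ≤ T.card := by
    by_contra hcon
    have h1 : T.card = 1 := by
      have := Finset.card_pos.2 hne
      omega
    obtain ⟨v, hv⟩ := Finset.card_eq_one.1 h1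
    have : S ⊆ {v} := by
      intro x hx
      have := hull x hx
      rw [hv] at this
      simpa using this
    have := Finset.card_le_card this
    simp at this
    omega
  have wT : ∀ i, i < T.card → w i ∈ T := fun i hi => (hw _).2 ⟨i, hi, rfl⟩
  have wS : ∀ i, i < T.card → w i ∈ S := fun i hi => h.subset (wT i hi)
  -- a point off the hull vertices is strictly on the left of a line with the vertices on the left
  have left : ∀ p ∈ T, ∀ q ∈ T, p ≠ q → (∀ u ∈ T, 0 ≤ orient p q u) → ∀ x ∈ S \ T,
      0 < orient p q x := by
    intro p hp q hq hpq hall x hx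
    obtain ⟨hxS, hxT⟩ := Finset.mem_sdiff.1 hx
    refine lt_of_le_of_ne (orient_nonneg_of_mem_convexHull hall (hull x hxS))
      (hS.orient_ne_zero (h.subset hp) (h.subset hq) hxS hpq ?_ ?_).symm <;>
    · rintro rfl
      contradiction
  have winj : ∀ i j, i < T.card → j < T.card → w i = w j → i = j := by
    have : Set.InjOn w (Finset.range T.card) := by
      rw [← Finset.card_image_iff]
      have : (Finset.range T.card).image w = T := by
        ext t
        rw [hw]
        simp
      rw [this, Finset.card_range]
    intro i j hi hj e
    exact this (by simpa using hi) (by simpa using hj) e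
  have edge : ∀ i, i + 1 < T.card → ∀ x ∈ S \ T, 0 < orient (w i) (w (i + 1)) x := by
    intro i hi
    refine left _ (wT _ (by omega)) _ (wT _ hi) (fun e => ?_) ?_
    · have := winj _ _ (by omega) hi e
      omega
    · intro u hu
      obtain ⟨j, hj, rfl⟩ := (hw u).1 hu
      rcases lt_trichotomy j i with h1 | rfl | h1
      · rw [orient_rotate]; exact (hpos j i (i + 1) h1 (by omega) hi).le
      · simp
      · rcases (Nat.succ_le_of_lt h1).eq_or_lt with rfl | h2
        · simp
        · exact (hpos i (i + 1) j (by omega) h2 hj).le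
  have last : ∀ x ∈ S \ T, 0 < orient (w (T.card - 1)) (w 0) x := by
    refine left _ (wT _ (by omega)) _ (wT _ (by omega)) (fun e => ?_) ?_
    · have := winj _ _ (by omega) (by omega) e
      omega
    · intro u hu
      obtain ⟨j, hj, rfl⟩ := (hw u).1 hu
      rcases Nat.eq_zero_or_pos j with rfl | h1
      · simp
      · rcases (Nat.le_sub_one_of_lt hj).eq_or_lt with rfl | h2
        · simp
        · rw [← orient_rotate]
          exact (hpos 0 j (T.card - 1) h1 h2 (by omega)).le
  have hsub : S \ T ⊆ (Finset.range (T.card - 2)).biUnion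
      (fun i => triPoints S (w 0) (w (i + 1)) (w (i + 2))) := by
    intro x hx
    have hxS := (Finset.mem_sdiff.1 hx).1
    have hxT := (Finset.mem_sdiff.1 hx).2
    by_contra hcon
    simp only [Finset.mem_biUnion, Finset.mem_range, mem_triPoints, not_exists, not_and] at hcon
    -- A point in no fan triangle is left of every successive diagonal from `w 0`. The last of these
    -- is the closing hull edge traversed backwards, which contradicts `last`.
    have ind : ∀ i, i + 1 < T.card → 0 < orient (w 0) (w (i + 1)) x := by
      intro i
      induction i with
      | zero => exact fun hi => edge 0 hi x hx
      | succ i ih =>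
        intro hi
        by_contra hneg
        refine hcon i (by omega) hxS ⟨ih (by omega), edge (i + 1) hi x hx, ?_⟩
        rw [orient_swap]
        have hne := hS.orient_ne_zero (wS 0 (by omega)) (wS (i + 2) hi) hxS
          (fun e => by have := winj _ _ (by omega) (by omega) e; omega)
          (fun e => hxT (e ▸ wT (i + 2) hi)) (fun e => hxT (e ▸ wT 0 (by omega)))
        have := lt_of_le_of_ne (not_lt.1 hneg) hne
        linarith
    have h1 := ind (T.card - 2) (by omega)
    have h3 := last x hx
    rw [show T.card - 2 + 1 = T.card - 1 by omega, orient_swap] at h1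
    linarith
  have hcard := (Finset.card_le_card hsub).trans (Finset.card_biUnion_le_card_mul _ _ 2
    (fun i hi => by
      rw [Finset.mem_range] at hi
      exact htri _ (wS 0 (by omega)) _ (wS _ (by omega)) _ (wS _ (by omega))))
  rw [Finset.card_range, Finset.card_sdiff_of_subset h.subset] at hcard
  omega

/-- Eighteen points without a `6`-hole span a triangle with three points inside. -/
theorem hasHole_six_of_card_triPoints_le {S : Finset Plane} (hS : InGeneralPosition S)
    (h18 : 18 ≤ S.card) (htri : ∀ a ∈ S, ∀ b ∈ S, ∀ c ∈ S, (triPoints S a b c).card ≤ 2) :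
    HasHole 6 S := by
  have := card_le_of_card_triPoints_le hS (by omega) htri
  exact (isConvexPolygon_hullVertices hS).hasHole_of_eight_le_card (by omega) htri

/-! ### The hexagon of a star is a pseudo-triangle. -/

theorem mem_segment_orient {u v x : Plane} (hx : x ∈ segment ℝ u v) :
    ∃ s t : ℝ, 0 ≤ s ∧ 0 ≤ t ∧ s + t = 1 ∧ x = s • u + t • v ∧
      ∀ a b, orient a b x = s * orient a b u + t * orient a b v := by
  obtain ⟨s, t, hs, ht, hst, rfl⟩ := hx
  exact ⟨s, t, hs, ht, hst, rfl, fun a b => orient_combo a b u v hst⟩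

theorem orient_nonneg_of_mem_segment {a b u v x : Plane} (hu : 0 ≤ orient a b u)
    (hv : 0 ≤ orient a b v) (hx : x ∈ segment ℝ u v) : 0 ≤ orient a b x := by
  obtain ⟨s, t, hs, ht, -, -, h⟩ := mem_segment_orient hx
  rw [h]
  positivity

theorem orient_nonpos_of_mem_segment {a b u v x : Plane} (hu : orient a b u ≤ 0)
    (hv : orient a b v ≤ 0) (hx : x ∈ segment ℝ u v) : orient a b x ≤ 0 := by
  have := orient_nonneg_of_mem_segment (a := b) (b := a) (by rw [orient_swap]; linarith)
    (by rw [orient_swap]; linarith) hx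
  rw [orient_swap] at this
  linarith

theorem eq_barycentric {a b c : Plane} (x : Plane) (h : orient a b c ≠ 0) :
    x = (orient b c x / orient a b c) • a + (orient c a x / orient a b c) • b +
      (orient a b x / orient a b c) • c := by
  apply plane_ext <;> simp only [PiLp.add_apply, PiLp.smul_apply, smul_eq_mul] <;>
    field_simp <;> unfold orient <;> ring

/-- The ray is connected and unbounded, and it lies in the component of `x` in the complement of the
boundary. -/
theorem Polygon.not_mem_inside_of_ray {n : ℕ} {P : Polygon Plane n} {x d : Plane} (hd : d ≠ 0)
    (h : ∀ t : ℝ, 0 ≤ t → x + t • d ∉ P.boundary ℝ) : x ∉ P.inside := by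
  rintro ⟨-, hb⟩
  have hpre : IsPreconnected ((fun t : ℝ => x + t • d) '' Set.Ici 0) :=
    isPreconnected_Ici.image _ (by fun_prop)
  have hsub : (fun t : ℝ => x + t • d) '' Set.Ici 0 ⊆
      connectedComponentIn (P.boundary ℝ)ᶜ x := by
    refine hpre.subset_connectedComponentIn ⟨0, by simp, by simp⟩ ?_
    rintro _ ⟨t, ht, rfl⟩
    exact h t ht
  obtain ⟨R, hR⟩ := (hb.subset hsub).subset_closedBall x
  have hd' : 0 < ‖d‖ := norm_pos_iff.2 hd
  have hmem := hR ⟨(|R| + 1) / ‖d‖, by simp only [Set.mem_Ici]; positivity, rfl⟩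
  simp only [Metric.mem_closedBall, dist_self_add_left, norm_smul, norm_div, Real.norm_eq_abs,
    abs_norm] at hmem
  rw [div_mul_cancel₀ _ hd'.ne', abs_of_pos (by positivity)] at hmem
  linarith [le_abs_self R]

/-- The points `p`, `q`, `r` inside the counterclockwise triangle `A B C` are such that the
triangles `A p B`, `B q C`, `C r A` overlap only in the vertices `A`, `B`, `C`. -/
structure IsStar (A p B q C r : Plane) : Prop where
  left : InTri A B C p
  mid : InTri A B C q
  right : InTri A B C r
  sepA : 0 < orient A p r
  sepB : 0 < orient B q p
  sepC : 0 < orient C r q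

/-- The hexagon `A p B q C r`. -/
def starPolygon (A p B q C r : Plane) : Polygon Plane 6 := ⟨![A, p, B, q, C, r]⟩

/-- The part of the triangle `A B C` that the triangles `A p B`, `B q C`, `C r A` leave free. -/
def starRegion (A p B q C r : Plane) : Set Plane :=
  {x | InTri A B C x ∧ ¬ (0 ≤ orient B p x ∧ 0 ≤ orient p A x) ∧
    ¬ (0 ≤ orient C q x ∧ 0 ≤ orient q B x) ∧ ¬ (0 ≤ orient A r x ∧ 0 ≤ orient r C x)}

/-- The complement of the closure of `starRegion`. -/
def starOuter (A p B q C r : Plane) : Set Plane :=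
  {x | (orient A B x < 0 ∨ orient B C x < 0 ∨ orient C A x < 0) ∨
    (0 < orient B p x ∧ 0 < orient p A x) ∨ (0 < orient C q x ∧ 0 < orient q B x) ∨
    (0 < orient A r x ∧ 0 < orient r C x)}

theorem starRegion_rotate (A p B q C r : Plane) :
    starRegion B q C r A p = starRegion A p B q C r := by
  ext x
  simp only [starRegion, InTri, Set.mem_ofPred_eq]
  tauto

theorem starPolygon_edgeSet (A p B q C r : Plane) :
    (starPolygon A p B q C r).edgeSet ℝ 0 = segment ℝ A p ∧
    (starPolygon A p B q C r).edgeSet ℝ 1 = segment ℝ p B ∧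
    (starPolygon A p B q C r).edgeSet ℝ 2 = segment ℝ B q ∧
    (starPolygon A p B q C r).edgeSet ℝ 3 = segment ℝ q C ∧
    (starPolygon A p B q C r).edgeSet ℝ 4 = segment ℝ C r ∧
    (starPolygon A p B q C r).edgeSet ℝ 5 = segment ℝ r A := by
  simp only [Polygon.edgeSet, affineSegment_eq_segment]
  exact ⟨rfl, rfl, rfl, rfl, rfl, rfl⟩

theorem mem_starPolygon_boundary {A p B q C r x : Plane} :
    x ∈ (starPolygon A p B q C r).boundary ℝ ↔
      (x ∈ segment ℝ A p ∨ x ∈ segment ℝ p B) ∨ (x ∈ segment ℝ B q ∨ x ∈ segment ℝ q C) ∨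
        (x ∈ segment ℝ C r ∨ x ∈ segment ℝ r A) := by
  obtain ⟨h0, h1, h2, h3, h4, h5⟩ := starPolygon_edgeSet A p B q C r
  simp only [Polygon.boundary, Set.mem_iUnion]
  constructor
  · rintro ⟨i, hi⟩
    fin_cases i
    · exact Or.inl (Or.inl (h0 ▸ hi))
    · exact Or.inl (Or.inr (h1 ▸ hi))
    · exact Or.inr (Or.inl (Or.inl (h2 ▸ hi)))
    · exact Or.inr (Or.inl (Or.inr (h3 ▸ hi)))
    · exact Or.inr (Or.inr (Or.inl (h4 ▸ hi)))
    · exact Or.inr (Or.inr (Or.inr (h5 ▸ hi)))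
  · rintro ((h | h) | (h | h) | (h | h))
    · exact ⟨0, h0 ▸ h⟩
    · exact ⟨1, h1 ▸ h⟩
    · exact ⟨2, h2 ▸ h⟩
    · exact ⟨3, h3 ▸ h⟩
    · exact ⟨4, h4 ▸ h⟩
    · exact ⟨5, h5 ▸ h⟩

theorem starPolygon_boundary_rotate (A p B q C r : Plane) :
    (starPolygon B q C r A p).boundary ℝ = (starPolygon A p B q C r).boundary ℝ := by
  ext x
  simp only [mem_starPolygon_boundary]
  tauto

namespace IsStar

variable {A p B q C r x : Plane}

theorem rotate (h : IsStar A p B q C r) : IsStar B q C r A p :=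
  ⟨h.mid.rotate, h.right.rotate, h.left.rotate, h.sepB, h.sepC, h.sepA⟩

theorem orient_B_p_A (h : IsStar A p B q C r) : 0 < orient B p A := by
  rw [orient_rotate]; exact h.left.1

theorem orient_p_A_B (h : IsStar A p B q C r) : 0 < orient p A B := by
  rw [orient_rotate, orient_rotate]; exact h.left.1

theorem orient_B_p_C (h : IsStar A p B q C r) : orient B p C < 0 := by
  rw [orient_swap_right]; linarith [h.left.2.1]

theorem orient_B_p_q (h : IsStar A p B q C r) : orient B p q < 0 := by
  rw [orient_swap_right]; linarith [h.sepB]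

theorem orient_p_A_C (h : IsStar A p B q C r) : orient p A C < 0 := by
  rw [orient_swap, ← orient_rotate, ← orient_rotate]; linarith [h.left.2.2]

theorem orient_p_A_r (h : IsStar A p B q C r) : orient p A r < 0 := by
  rw [orient_swap]; linarith [h.sepA]

theorem pocket_closed (h : IsStar A p B q C r) (hx : x ∈ segment ℝ A p ∨ x ∈ segment ℝ p B) :
    0 ≤ orient B p x ∧ 0 ≤ orient p A x := by
  rcases hx with hx | hx
  · exact ⟨orient_nonneg_of_mem_segment h.orient_B_p_A.le (by simp) hx,
      orient_nonneg_of_mem_segment (by simp) (by simp) hx⟩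
  · exact ⟨orient_nonneg_of_mem_segment (by simp) (by simp) hx,
      orient_nonneg_of_mem_segment (by simp) h.orient_p_A_B.le hx⟩

theorem orient_nonneg_of_mem_boundary (h : IsStar A p B q C r)
    (hx : x ∈ (starPolygon A p B q C r).boundary ℝ) : 0 ≤ orient A B x := by
  have hC : 0 ≤ orient A B C := h.left.orient_pos.le
  rcases mem_starPolygon_boundary.1 hx with (hx | hx) | (hx | hx) | (hx | hx)
  · exact orient_nonneg_of_mem_segment (by simp) h.left.1.le hx
  · exact orient_nonneg_of_mem_segment h.left.1.le (by simp) hx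
  · exact orient_nonneg_of_mem_segment (by simp) h.mid.1.le hx
  · exact orient_nonneg_of_mem_segment h.mid.1.le hC hx
  · exact orient_nonneg_of_mem_segment hC h.right.1.le hx
  · exact orient_nonneg_of_mem_segment h.right.1.le (by simp) hx

/-- The open cone at `p` spanned by `A` and `B` has the edges at `p` on its sides. The edges at `q`
are not left of `B p`, and those at `r` are not left of `p A`. -/
theorem not_mem_boundary_of_mem_cone (h : IsStar A p B q C r) (h1 : 0 < orient B p x)
    (h2 : 0 < orient p A x) : x ∉ (starPolygon A p B q C r).boundary ℝ := by
  intro hx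
  rcases mem_starPolygon_boundary.1 hx with (hx | hx) | (hx | hx) | (hx | hx)
  · exact absurd (orient_nonpos_of_mem_segment (by simp) (by simp) hx) (not_le.2 h2)
  · exact absurd (orient_nonpos_of_mem_segment (by simp) (by simp) hx) (not_le.2 h1)
  · exact absurd (orient_nonpos_of_mem_segment (by simp) h.orient_B_p_q.le hx) (not_le.2 h1)
  · exact absurd (orient_nonpos_of_mem_segment h.orient_B_p_q.le h.orient_B_p_C.le hx)
      (not_le.2 h1)
  · exact absurd (orient_nonpos_of_mem_segment h.orient_p_A_C.le h.orient_p_A_r.le hx)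
      (not_le.2 h2)
  · exact absurd (orient_nonpos_of_mem_segment h.orient_p_A_r.le (by simp) hx) (not_le.2 h2)

theorem not_mem_inside_of_orient_neg (h : IsStar A p B q C r) (hx : orient A B x < 0) :
    x ∉ (starPolygon A p B q C r).inside := by
  have hAB : A ≠ B := by
    rintro rfl
    simp at hx
  obtain ⟨d, hd⟩ := exists_orient_direction hAB
  refine Polygon.not_mem_inside_of_ray (d := d) ?_ ?_
  · rintro rfl
    have := hd x 1
    simp only [smul_zero, add_zero] at this
    linarith
  · intro t ht hb
    have := h.orient_nonneg_of_mem_boundary hb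
    rw [hd] at this
    linarith

/-- The ray from `x` away from the apex `p` stays in the cone. -/
theorem not_mem_inside_of_mem_cone (h : IsStar A p B q C r) (h1 : 0 < orient B p x)
    (h2 : 0 < orient p A x) : x ∉ (starPolygon A p B q C r).inside := by
  refine Polygon.not_mem_inside_of_ray (d := x - p) ?_ ?_
  · intro e
    rw [sub_eq_zero.1 e] at h1
    simp at h1
  · intro t ht
    apply h.not_mem_boundary_of_mem_cone
    · have : orient B p (x + t • (x - p)) = (1 + t) * orient B p x := by
        simp only [orient, PiLp.add_apply, PiLp.smul_apply, PiLp.sub_apply, smul_eq_mul]; ring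
      rw [this]; positivity
    · have : orient p A (x + t • (x - p)) = (1 + t) * orient p A x := by
        simp only [orient, PiLp.add_apply, PiLp.smul_apply, PiLp.sub_apply, smul_eq_mul]; ring
      rw [this]; positivity

theorem inside_rotate (A p B q C r : Plane) :
    (starPolygon B q C r A p).inside = (starPolygon A p B q C r).inside := by
  simp only [Polygon.inside, starPolygon_boundary_rotate]

theorem not_mem_inside_of_mem_outer (h : IsStar A p B q C r) (hx : x ∈ starOuter A p B q C r) :
    x ∉ (starPolygon A p B q C r).inside := by
  have e1 := inside_rotate A p B q C r
  have e2 := inside_rotate B q C r A p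
  rcases hx with (hx | hx | hx) | hx | hx | hx
  · exact h.not_mem_inside_of_orient_neg hx
  · exact e1 ▸ h.rotate.not_mem_inside_of_orient_neg hx
  · exact e1 ▸ e2 ▸ h.rotate.rotate.not_mem_inside_of_orient_neg hx
  · exact h.not_mem_inside_of_mem_cone hx.1 hx.2
  · exact e1 ▸ h.rotate.not_mem_inside_of_mem_cone hx.1 hx.2
  · exact e1 ▸ e2 ▸ h.rotate.rotate.not_mem_inside_of_mem_cone hx.1 hx.2

theorem mem_boundary_of_pocket (h : IsStar A p B q C r) (h0 : 0 ≤ orient A B x)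
    (h1 : 0 ≤ orient B p x) (h2 : 0 ≤ orient p A x) (hn : ¬ (0 < orient B p x ∧ 0 < orient p A x)) :
    x ∈ (starPolygon A p B q C r).boundary ℝ := by
  have hD := h.left.1
  have key := eq_barycentric x hD.ne'
  have hsum : orient A B p = orient A B x + orient B p x + orient p A x := by
    unfold orient; ring
  rw [mem_starPolygon_boundary]
  left
  rcases h1.eq_or_lt with h1' | h1'
  · right
    rw [← h1', zero_div, zero_smul, zero_add] at key
    refine ⟨orient A B x / orient A B p, orient p A x / orient A B p, by positivity, by positivity,
      ?_, by rw [add_comm]; exact key.symm⟩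
    rw [← add_div, div_eq_one_iff_eq hD.ne']; linarith
  · left
    have h2' : orient p A x = 0 := le_antisymm (not_lt.1 fun hh => hn ⟨h1', hh⟩) h2
    rw [h2', zero_div, zero_smul, add_zero] at key
    refine ⟨orient B p x / orient A B p, orient A B x / orient A B p, by positivity, by positivity,
      ?_, key.symm⟩
    rw [← add_div, div_eq_one_iff_eq hD.ne']; linarith

theorem mem_boundary_of_edge (h : IsStar A p B q C r) (h0 : orient A B x = 0)
    (h1 : 0 ≤ orient B C x) (h2 : 0 ≤ orient C A x)
    (hn : ¬ (0 < orient B p x ∧ 0 < orient p A x)) :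
    x ∈ (starPolygon A p B q C r).boundary ℝ := by
  have hD := h.left.orient_pos
  refine h.mem_boundary_of_pocket h0.ge ?_ ?_ hn
  · have e : orient B p x * orient A B C =
        orient A B p * orient B C x - orient A B x * orient B C p := by
      unfold orient; ring
    rw [h0] at e
    have : 0 ≤ orient B p x * orient A B C := by
      rw [e]; nlinarith [mul_nonneg h.left.1.le h1]
    exact nonneg_of_mul_nonneg_left this hD
  · have e : orient p A x * orient A B C =
        orient A B p * orient C A x - orient A B x * orient C A p := by
      unfold orient; ring
    rw [h0] at e
    have : 0 ≤ orient p A x * orient A B C := by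
      rw [e]; nlinarith [mul_nonneg h.left.1.le h2]
    exact nonneg_of_mul_nonneg_left this hD

theorem compl_boundary_subset (h : IsStar A p B q C r) :
    ((starPolygon A p B q C r).boundary ℝ)ᶜ ⊆ starRegion A p B q C r ∪ starOuter A p B q C r := by
  intro x hx
  by_contra hcon
  simp only [Set.mem_union, not_or] at hcon
  obtain ⟨hR, hO⟩ := hcon
  simp only [starOuter, Set.mem_ofPred_eq, not_or, not_lt] at hO
  obtain ⟨⟨a1, a2, a3⟩, b1, b2, b3⟩ := hO
  have e1 := starPolygon_boundary_rotate A p B q C r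
  have e2 := starPolygon_boundary_rotate B q C r A p
  apply hx
  rcases a1.eq_or_lt with c1 | c1
  · exact h.mem_boundary_of_edge c1.symm a2 a3 b1
  rcases a2.eq_or_lt with c2 | c2
  · exact e1 ▸ h.rotate.mem_boundary_of_edge c2.symm a3 a1 b2
  rcases a3.eq_or_lt with c3 | c3
  · exact e1 ▸ e2 ▸ h.rotate.rotate.mem_boundary_of_edge c3.symm a1 a2 b3
  by_cases d1 : 0 ≤ orient B p x ∧ 0 ≤ orient p A x
  · exact h.mem_boundary_of_pocket a1 d1.1 d1.2 b1
  by_cases d2 : 0 ≤ orient C q x ∧ 0 ≤ orient q B x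
  · exact e1 ▸ h.rotate.mem_boundary_of_pocket a2 d2.1 d2.2 b2
  by_cases d3 : 0 ≤ orient A r x ∧ 0 ≤ orient r C x
  · exact e1 ▸ e2 ▸ h.rotate.rotate.mem_boundary_of_pocket a3 d3.1 d3.2 b3
  exact (hR ⟨⟨c1, c2, c3⟩, d1, d2, d3⟩).elim

theorem not_mem_boundary_of_mem_region (h : IsStar A p B q C r) (hx : x ∈ starRegion A p B q C r) :
    x ∉ (starPolygon A p B q C r).boundary ℝ := by
  intro hb
  obtain ⟨-, h1, h2, h3⟩ := hx
  rcases mem_starPolygon_boundary.1 hb with hb | hb | hb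
  · exact h1 (h.pocket_closed hb)
  · exact h2 (h.rotate.pocket_closed hb)
  · exact h3 (h.rotate.rotate.pocket_closed hb)

theorem _root_.isOpen_starRegion (A p B q C r : Plane) : IsOpen (starRegion A p B q C r) := by
  have cone : ∀ a b c d : Plane, IsOpen {x | ¬ (0 ≤ orient a b x ∧ 0 ≤ orient c d x)} := by
    intro a b c d
    have : IsClosed {x | 0 ≤ orient a b x ∧ 0 ≤ orient c d x} :=
      (isClosed_le continuous_const (continuous_orient a b)).inter
        (isClosed_le continuous_const (continuous_orient c d))
    exact this.isOpen_compl
  exact (isOpen_inTri A B C).inter ((cone _ _ _ _).inter ((cone _ _ _ _).inter (cone _ _ _ _)))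

theorem _root_.isOpen_starOuter (A p B q C r : Plane) : IsOpen (starOuter A p B q C r) := by
  have half : ∀ a b : Plane, IsOpen {x | orient a b x < 0} := fun a b =>
    isOpen_lt (continuous_orient a b) continuous_const
  have cone : ∀ a b c d : Plane, IsOpen {x | 0 < orient a b x ∧ 0 < orient c d x} :=
    fun a b c d => (isOpen_lt continuous_const (continuous_orient a b)).inter
        (isOpen_lt continuous_const (continuous_orient c d))
  exact ((half _ _).union ((half _ _).union (half _ _))).union
    ((cone _ _ _ _).union ((cone _ _ _ _).union (cone _ _ _ _)))

theorem disjoint_region_outer : Disjoint (starRegion A p B q C r) (starOuter A p B q C r) := by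
  rw [Set.disjoint_left]
  rintro x ⟨⟨a1, a2, a3⟩, b1, b2, b3⟩ hO
  rcases hO with (hx | hx | hx) | hx | hx | hx
  · exact absurd hx (not_lt.2 a1.le)
  · exact absurd hx (not_lt.2 a2.le)
  · exact absurd hx (not_lt.2 a3.le)
  · exact b1 ⟨hx.1.le, hx.2.le⟩
  · exact b2 ⟨hx.1.le, hx.2.le⟩
  · exact b3 ⟨hx.1.le, hx.2.le⟩

/-- This replaces the Jordan curve theorem: `starRegion` and `starOuter` are disjoint open sets
covering the complement of the boundary, so a component that meets `starRegion` stays there and is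
bounded, while from a point of `starOuter` some ray escapes. -/
theorem inside_eq (h : IsStar A p B q C r) :
    (starPolygon A p B q C r).inside = starRegion A p B q C r := by
  ext x
  constructor
  · intro hx
    rcases h.compl_boundary_subset hx.1 with hR | hO
    · exact hR
    · exact absurd hx (h.not_mem_inside_of_mem_outer hO)
  · intro hx
    have hb := h.not_mem_boundary_of_mem_region hx
    refine ⟨hb, ?_⟩
    have hsub : connectedComponentIn ((starPolygon A p B q C r).boundary ℝ)ᶜ x ⊆
        starRegion A p B q C r :=
      IsPreconnected.subset_left_of_subset_union (isOpen_starRegion A p B q C r)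
        (isOpen_starOuter A p B q C r) disjoint_region_outer
        ((connectedComponentIn_subset _ _).trans h.compl_boundary_subset)
        ⟨x, mem_connectedComponentIn hb, hx⟩ isPreconnected_connectedComponentIn
    have hbd : Bornology.IsBounded (convexHull ℝ ({A, B, C} : Set Plane)) :=
      isBounded_convexHull.2 (Set.toFinite _).isBounded
    refine hbd.subset (hsub.trans ?_)
    rintro y ⟨hy, -⟩
    exact mem_convexHull_triple_of_orient_nonneg hy.orient_pos hy.1.le hy.2.1.le hy.2.2.le

theorem ne_A_p (h : IsStar A p B q C r) : A ≠ p := by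
  rintro rfl; simpa using h.left.1

theorem ne_p_B (h : IsStar A p B q C r) : p ≠ B := by
  rintro rfl; simpa using h.left.1

theorem ne_A_B (h : IsStar A p B q C r) : A ≠ B := by
  rintro rfl; simpa using h.left.1

theorem ne_p_q (h : IsStar A p B q C r) : p ≠ q := by
  rintro rfl; simpa using h.sepB

theorem ne_A_q (h : IsStar A p B q C r) : A ≠ q := by
  rintro rfl; simpa using h.mid.1

theorem edges_Ap_pB (h : IsStar A p B q C r) (h1 : x ∈ segment ℝ A p) (h2 : x ∈ segment ℝ p B) :
    x = p := by
  obtain ⟨s, t, hs, ht, hst, hx, e⟩ := mem_segment_orient h1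
  obtain ⟨s', t', hs', ht', hst', hx', e'⟩ := mem_segment_orient h2
  have k1 := e B p
  rw [e' B p] at k1
  simp only [orient_self_right, orient_self_outer, mul_zero, add_zero] at k1
  have : s = 0 := by
    rcases mul_eq_zero.1 k1.symm with h0 | h0
    · exact h0
    · exact absurd h0 h.orient_B_p_A.ne'
  subst this
  obtain rfl : t = 1 := by linarith
  simpa using hx

theorem edges_pB_Bq (h : IsStar A p B q C r) (h1 : x ∈ segment ℝ p B) (h2 : x ∈ segment ℝ B q) :
    x = B := by
  obtain ⟨s, t, hs, ht, hst, hx, e⟩ := mem_segment_orient h1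
  obtain ⟨s', t', hs', ht', hst', hx', e'⟩ := mem_segment_orient h2
  have k1 := e B p
  rw [e' B p] at k1
  simp only [orient_self_right, orient_self_outer, mul_zero, add_zero, zero_add] at k1
  have : t' = 0 := by
    rcases mul_eq_zero.1 k1 with h0 | h0
    · exact h0
    · exact absurd h0 h.orient_B_p_q.ne
  subst this
  obtain rfl : s' = 1 := by linarith
  simpa using hx'

/-- The line `B p` separates the two segments, and `A p` meets it only in `p`, which is not on `B
q`. -/
theorem edges_Ap_Bq (h : IsStar A p B q C r) (h1 : x ∈ segment ℝ A p) (h2 : x ∈ segment ℝ B q) :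
    False := by
  obtain ⟨s, t, hs, ht, hst, hx, e⟩ := mem_segment_orient h1
  have hle := orient_nonpos_of_mem_segment (a := B) (b := p) (by simp) h.orient_B_p_q.le h2
  have k1 := e B p
  simp only [orient_self_right, mul_zero, add_zero] at k1
  have hpos := h.orient_B_p_A
  have : s = 0 := by
    by_contra hs0
    have : 0 < s := lt_of_le_of_ne hs (Ne.symm hs0)
    nlinarith [mul_pos this hpos]
  subst this
  obtain rfl : t = 1 := by linarith
  have hxp : x = p := by simpa using hx
  have := h.edges_pB_Bq (hxp ▸ left_mem_segment ℝ p B) h2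
  exact h.ne_p_B (hxp ▸ this)

theorem edges_pocket_qC (h : IsStar A p B q C r) (h1 : x ∈ segment ℝ A p ∨ x ∈ segment ℝ p B)
    (h2 : x ∈ segment ℝ q C) : False := by
  obtain ⟨s, t, hs, ht, hst, hx, e⟩ := mem_segment_orient h2
  have k1 := (h.pocket_closed h1).1
  rw [e B p] at k1
  have hC := h.orient_B_p_C
  have hq := h.orient_B_p_q
  rcases hs.eq_or_lt with rfl | hs
  · obtain rfl : t = 1 := by linarith
    linarith
  · nlinarith [mul_neg_of_pos_of_neg hs hq, mul_nonneg ht (neg_nonneg.2 hC.le)]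

theorem vertices_injective (h : IsStar A p B q C r) :
    Function.Injective (starPolygon A p B q C r).vertices := by
  have h' := h.rotate
  have h'' := h'.rotate
  have n : (![A, p, B, q, C, r] : Fin 6 → Plane).Injective := by
    rw [← List.nodup_ofFn]
    simp [List.ofFn_succ, h.ne_A_p, h.ne_A_B, h.ne_A_q, h''.ne_A_B.symm, h''.ne_p_B.symm,
      h.ne_p_B, h.ne_p_q, h''.ne_A_q.symm, h''.ne_p_q.symm, h'.ne_A_p, h'.ne_A_B, h'.ne_A_q,
      h'.ne_p_B, h'.ne_p_q, h''.ne_A_p]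
  exact n

theorem isSimple (h : IsStar A p B q C r) : (starPolygon A p B q C r).IsSimple := by
  refine ⟨by norm_num, h.vertices_injective, ?_⟩
  obtain ⟨e0, e1, e2, e3, e4, e5⟩ := starPolygon_edgeSet A p B q C r
  have h' := h.rotate
  have h'' := h'.rotate
  have main : ∀ i j : Fin 6, i < j → ∀ x ∈ (starPolygon A p B q C r).edgeSet ℝ i ∩
      (starPolygon A p B q C r).edgeSet ℝ j,
      (j = finRotate 6 i ∧ x = (starPolygon A p B q C r) j) ∨
        (i = finRotate 6 j ∧ x = (starPolygon A p B q C r) i) := by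
    rintro i j hij x ⟨hi, hj⟩
    -- The fifteen pairs of edges reduce to a few kinds under the rotations of the star.
    fin_cases i <;> fin_cases j <;> first | exact absurd hij (by decide) | skip
    all_goals
      simp only [Fin.zero_eta, Fin.mk_one, Fin.reduceFinMk, e0, e1, e2, e3, e4, e5] at hi hj
    · exact Or.inl ⟨rfl, h.edges_Ap_pB hi hj⟩
    · exact (h.edges_Ap_Bq hi hj).elim
    · exact (h.edges_pocket_qC (Or.inl hi) hj).elim
    · exact (h''.edges_Ap_Bq hj hi).elim
    · exact Or.inr ⟨rfl, h''.edges_pB_Bq hj hi⟩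
    · exact Or.inl ⟨rfl, h.edges_pB_Bq hi hj⟩
    · exact (h.edges_pocket_qC (Or.inr hi) hj).elim
    · exact (h''.edges_pocket_qC (Or.inl hj) hi).elim
    · exact (h''.edges_pocket_qC (Or.inr hj) hi).elim
    · exact Or.inl ⟨rfl, h'.edges_Ap_pB hi hj⟩
    · exact (h'.edges_Ap_Bq hi hj).elim
    · exact (h'.edges_pocket_qC (Or.inl hi) hj).elim
    · exact Or.inl ⟨rfl, h'.edges_pB_Bq hi hj⟩
    · exact (h'.edges_pocket_qC (Or.inr hi) hj).elim
    · exact Or.inl ⟨rfl, h''.edges_Ap_pB hi hj⟩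
  intro i j hij x hx
  rcases lt_or_gt_of_ne hij with hlt | hlt
  · exact main i j hlt x hx
  · exact (main j i hlt x hx.symm).symm

/-- Close to `A` a point is certainly left of `B p` and of `r C`. To avoid both pockets at `A` it
must therefore lie strictly between the rays to `p` and `r`, and Cramer's rule gives the
coefficients. -/
theorem exists_sector_near (h : IsStar A p B q C r) :
    ∃ ε > 0, ∀ x ∈ starRegion A p B q C r, dist x A < ε →
      ∃ s t : ℝ, 0 < s ∧ 0 < t ∧ x = A + s • (r - A) + t • (p - A) := by
  have hr := h.rotate.rotate.orient_p_A_B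
  have hU : IsOpen {x | 0 < orient B p x ∧ 0 < orient r C x} :=
    (isOpen_lt continuous_const (continuous_orient B p)).inter
      (isOpen_lt continuous_const (continuous_orient r C))
  obtain ⟨ε, hε, hball⟩ := Metric.isOpen_iff.1 hU A ⟨h.orient_B_p_A, hr⟩
  refine ⟨ε, hε, ?_⟩
  rintro x ⟨-, h1, -, h3⟩ hdist
  obtain ⟨k1, k2⟩ := hball (Metric.mem_ball.2 hdist)
  have m1 : 0 < orient A p x := by
    rw [orient_swap]
    by_contra hcon
    exact h1 ⟨le_of_lt k1, by linarith⟩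
  have m2 : orient A r x < 0 := by
    by_contra hcon
    exact h3 ⟨not_lt.1 hcon, le_of_lt k2⟩
  have hD := h.sepA
  refine ⟨orient A p x / orient A p r, -orient A r x / orient A p r, by positivity,
    div_pos (by linarith) hD, ?_⟩
  apply plane_ext <;>
    simp only [PiLp.add_apply, PiLp.smul_apply, PiLp.sub_apply, smul_eq_mul] <;>
    field_simp <;> unfold orient <;> ring

/-- Prolong `A p` slightly beyond `p`: this crosses to the right of `B p`, whereas the convex sector
at `p` is on the left, and a short step enters no other pocket. -/
theorem exists_reflex_near (h : IsStar A p B q C r) {ε : ℝ} (hε : 0 < ε) :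
    ∃ x ∈ starRegion A p B q C r, dist x p < ε ∧
      ¬ ∃ s t : ℝ, 0 < s ∧ 0 < t ∧ x = p + s • (A - p) + t • (B - p) := by
  have hU : IsOpen {x | InTri A B C x ∧ orient q B x < 0 ∧ orient A r x < 0} :=
    (isOpen_inTri A B C).inter ((isOpen_lt (continuous_orient q B) continuous_const).inter
      (isOpen_lt (continuous_orient A r) continuous_const))
  have hp : p ∈ {x | InTri A B C x ∧ orient q B x < 0 ∧ orient A r x < 0} :=
    ⟨h.left, h.rotate.orient_p_A_r, h.rotate.rotate.orient_B_p_q⟩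
  obtain ⟨δ, hδ, hball⟩ := Metric.isOpen_iff.1 hU p hp
  have hc : Continuous fun t : ℝ => p + t • (p - A) := by fun_prop
  obtain ⟨η, hη, hη'⟩ := Metric.continuousAt_iff.1 (hc.continuousAt (x := 0)) (min δ ε)
    (lt_min hδ hε)
  have hd := hη' (x := η / 2) (by simp [abs_of_pos hη, hη])
  simp only [zero_smul, add_zero] at hd
  obtain ⟨k1, k2, k3⟩ := hball (Metric.mem_ball.2 (hd.trans_le (min_le_left _ _)))
  have neg : orient B p (p + (η / 2) • (p - A)) < 0 := by
    have e : orient B p (p + (η / 2) • (p - A)) = -(η / 2 * orient B p A) := by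
      simp only [orient, PiLp.add_apply, PiLp.smul_apply, PiLp.sub_apply, smul_eq_mul]; ring
    rw [e]
    have := h.orient_B_p_A
    have : 0 < η / 2 * orient B p A := by positivity
    linarith
  refine ⟨p + (η / 2) • (p - A), ⟨k1, fun hh => absurd hh.1 (not_le.2 neg),
    fun hh => absurd hh.2 (not_le.2 k2), fun hh => absurd hh.1 (not_le.2 k3)⟩,
    hd.trans_le (min_le_right _ _), ?_⟩
  rintro ⟨s, t, hs, ht, e⟩
  have e' : orient B p (p + s • (A - p) + t • (B - p)) = s * orient B p A := by
    simp only [orient, PiLp.add_apply, PiLp.smul_apply, PiLp.sub_apply, smul_eq_mul]; ring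
  rw [e, e'] at neg
  have := h.orient_B_p_A
  have : 0 < s * orient B p A := by positivity
  linarith

theorem isPseudoTriangle (h : IsStar A p B q C r) :
    (starPolygon A p B q C r).IsPseudoTriangle := by
  refine ⟨h.isSimple, ?_⟩
  have h' := h.rotate
  have h'' := h'.rotate
  have r1 := starRegion_rotate A p B q C r
  have r2 := starRegion_rotate B q C r A p
  have key : {i : Fin 6 | (starPolygon A p B q C r).IsConvexVertex i} = {0, 2, 4} := by
    ext i
    simp only [Set.mem_ofPred_eq, Polygon.IsConvexVertex, h.inside_eq, Polygon.convexSector,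
      Set.mem_insert_iff, Set.mem_singleton_iff]
    fin_cases i
    · exact iff_of_true h.exists_sector_near (Or.inl rfl)
    · refine iff_of_false ?_ (by decide)
      rintro ⟨ε, hε, hall⟩
      obtain ⟨x, hx, hd, hn⟩ := h.exists_reflex_near hε
      exact hn (hall x hx hd)
    · exact iff_of_true (r1 ▸ h'.exists_sector_near) (Or.inr (Or.inl rfl))
    · refine iff_of_false ?_ (by decide)
      rintro ⟨ε, hε, hall⟩
      obtain ⟨x, hx, hd, hn⟩ := h'.exists_reflex_near hε
      exact hn (hall x (r1 ▸ hx) hd)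
    · exact iff_of_true (r1 ▸ r2 ▸ h''.exists_sector_near) (Or.inr (Or.inr rfl))
    · refine iff_of_false ?_ (by decide)
      rintro ⟨ε, hε, hall⟩
      obtain ⟨x, hx, hd, hn⟩ := h''.exists_reflex_near hε
      exact hn (hall x (r1 ▸ r2 ▸ hx) hd)
  rw [key]
  rw [Set.ncard_eq_toFinset_card']
  rfl

/-- A star whose pockets contain all other points of `S` in the triangle `A B C`. -/
theorem hasEmptyPseudoTriangle (h : IsStar A p B q C r) {S : Finset Plane}
    (hA : A ∈ S) (hp : p ∈ S) (hB : B ∈ S) (hq : q ∈ S) (hC : C ∈ S)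
    (hr : r ∈ S) (hcov : ∀ x ∈ S, InTri A B C x → x ≠ p → x ≠ q → x ≠ r →
      (0 < orient B p x ∧ 0 < orient p A x) ∨ (0 < orient C q x ∧ 0 < orient q B x) ∨
        (0 < orient A r x ∧ 0 < orient r C x)) :
    HasEmptyPseudoTriangle 6 S := by
  refine ⟨starPolygon A p B q C r, ?_, h.isPseudoTriangle, ?_⟩
  · intro i
    fin_cases i <;> assumption
  · intro x hx hin
    rw [h.inside_eq] at hin
    have hb := h.not_mem_boundary_of_mem_region hin
    rw [mem_starPolygon_boundary] at hb
    refine Set.disjoint_left.1 disjoint_region_outer hin (Or.inr (hcov x hx hin.1 ?_ ?_ ?_))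
    · rintro rfl
      exact hb (Or.inl (Or.inl (right_mem_segment ℝ A x)))
    · rintro rfl
      exact hb (Or.inr (Or.inl (Or.inl (right_mem_segment ℝ B x))))
    · rintro rfl
      exact hb (Or.inr (Or.inr (Or.inl (right_mem_segment ℝ C x))))

end IsStar

/-! ### Pocket triples from three linear orders. -/

/-- The orders in which three rotating rays meet the points of a set, such that no pocket contains
three points: `p` has the pocket of the points before `p` in one order and after `p` in the next. -/
structure IsPocketSystem {α : Type*} (I : Finset α) (f g h : α → ℝ) : Prop where
  injOn₁ : Set.InjOn f I
  injOn₂ : Set.InjOn g I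
  injOn₃ : Set.InjOn h I
  not_agree : ∀ x ∈ I, ∀ y ∈ I, f x < f y → g x < g y → h x < h y → False
  pocket₁ : ∀ p ∈ I, ∀ x ∈ I, ∀ y ∈ I, ∀ z ∈ I, x ≠ y → x ≠ z → y ≠ z →
    f x < f p → g p < g x → f y < f p → g p < g y → f z < f p → g p < g z → False
  pocket₂ : ∀ p ∈ I, ∀ x ∈ I, ∀ y ∈ I, ∀ z ∈ I, x ≠ y → x ≠ z → y ≠ z →
    g x < g p → h p < h x → g y < g p → h p < h y → g z < g p → h p < h z → False
  pocket₃ : ∀ p ∈ I, ∀ x ∈ I, ∀ y ∈ I, ∀ z ∈ I, x ≠ y → x ≠ z → y ≠ z →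
    h x < h p → f p < f x → h y < h p → f p < f y → h z < h p → f p < f z → False

/-- Three points with disjoint pockets that contain all other points. -/
def HasPocketTriple {α : Type*} (I : Finset α) (f g h : α → ℝ) : Prop :=
  ∃ p ∈ I, ∃ q ∈ I, ∃ r ∈ I, f p < f r ∧ g q < g p ∧ h r < h q ∧
    ∀ x ∈ I, x ≠ p → x ≠ q → x ≠ r →
      (f x < f p ∧ g p < g x) ∨ (g x < g q ∧ h q < h x) ∨ (h x < h r ∧ f r < f x)

theorem HasPocketTriple.rotate {α : Type*} {I : Finset α} {f g h : α → ℝ}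
    (H : HasPocketTriple I g h f) : HasPocketTriple I f g h := by
  obtain ⟨q, hq, r, hr, p, hp, h1, h2, h3, hall⟩ := H
  refine ⟨p, hp, q, hq, r, hr, h3, h1, h2, fun x hx hxp hxq hxr => ?_⟩
  have := hall x hx hxq hxr hxp
  tauto

namespace IsPocketSystem

variable {α : Type*} {I : Finset α} {f g h : α → ℝ}

theorem rotate (H : IsPocketSystem I f g h) : IsPocketSystem I g h f :=
  ⟨H.injOn₂, H.injOn₃, H.injOn₁, fun x hx y hy h1 h2 h3 => H.not_agree x hx y hy h3 h1 h2,
    H.pocket₂, H.pocket₃, H.pocket₁⟩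

theorem lt_or_gt (H : IsPocketSystem I f g h) {x y : α} (hx : x ∈ I) (hy : y ∈ I) (hxy : x ≠ y) :
    f x < f y ∨ f y < f x :=
  lt_or_gt_of_ne fun e => hxy (H.injOn₁ hx hy e)

/-- The function `f` attains its maximum over `I` at `X` only. -/
def _root_.IsMaxPoint (I : Finset α) (f : α → ℝ) (X : α) : Prop :=
  X ∈ I ∧ ∀ x ∈ I, x ≠ X → f x < f X

theorem exists_isMaxPoint (H : IsPocketSystem I f g h) (hI : I.Nonempty) : ∃ X, IsMaxPoint I f X := by
  obtain ⟨X, hX, hmax⟩ := I.exists_max_image f hI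
  exact ⟨X, hX, fun x hx hne => lt_of_le_of_ne (hmax x hx) fun e => hne (H.injOn₁ hx hX e)⟩

/-- Nothing is left to cover; it remains to assign the roles of `p`, `q`, `r` so that the three
strict inequalities hold. -/
theorem triple_of_three (H : IsPocketSystem I f g h) {X s t : α} (hX : IsMaxPoint I f X) (hs : s ∈ I)
    (ht : t ∈ I) (hsX : s ≠ X) (htX : t ≠ X) (hI : ∀ x ∈ I, x = X ∨ x = s ∨ x = t)
    (hst : g s < g t) : HasPocketTriple I f g h := by
  have hXI := hX.1
  have a1 := hX.2 s hs hsX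
  have a2 := hX.2 t ht htX
  have hne : s ≠ t := by rintro rfl; exact lt_irrefl _ hst
  have cover : ∀ (p q r : α), (X = p ∨ X = q ∨ X = r) → (s = p ∨ s = q ∨ s = r) →
      (t = p ∨ t = q ∨ t = r) → ∀ x ∈ I, x ≠ p → x ≠ q → x ≠ r →
      (f x < f p ∧ g p < g x) ∨ (g x < g q ∧ h q < h x) ∨ (h x < h r ∧ f r < f x) := by
    intro p q r c1 c2 c3 x hx n1 n2 n3
    rcases hI x hx with rfl | rfl | rfl <;> tauto
  rcases H.rotate.rotate.lt_or_gt hs hXI hsX with b1 | b1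
  · have b2 : g X < g s := by
      rcases H.rotate.lt_or_gt hs hXI hsX with b2 | b2
      · exact (H.not_agree s hs X hXI a1 b2 b1).elim
      · exact b2
    rcases H.lt_or_gt hs ht hne with b3 | b3
    · exact ⟨s, hs, X, hXI, t, ht, b3, b2, by
        rcases H.rotate.rotate.lt_or_gt hs ht hne with b4 | b4
        · exact (H.not_agree s hs t ht b3 hst b4).elim
        · exact b4.trans b1, cover s X t (by tauto) (by tauto) (by tauto)⟩
    · exact ⟨t, ht, X, hXI, s, hs, b3, b2.trans hst, b1,
        cover t X s (by tauto) (by tauto) (by tauto)⟩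
  · exact ⟨t, ht, s, hs, X, hXI, a2, hst, b1, cover t s X (by tauto) (by tauto) (by tauto)⟩

/-- With four or more points, the maxima of the orders are different. -/
theorem maxPoint_ne_maxPoint (H : IsPocketSystem I f g h) (hI : 4 ≤ I.card) {X Y : α} (hX : IsMaxPoint I f X)
    (hY : IsMaxPoint I g Y) : X ≠ Y := by
  classical
  rintro rfl
  have h3 : 2 < (I.erase X).card := by
    rw [Finset.card_erase_of_mem hX.1]; omega
  obtain ⟨x, y, z, hx, hy, hz, hxy, hxz, hyz⟩ := Finset.two_lt_card_iff.1 h3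
  -- Since no point is below `X` in all three orders, all other points fall into one pocket of `X`,
  -- which is too small for three.
  have key : ∀ u ∈ I.erase X, g u < g X ∧ h X < h u := by
    intro u hu
    obtain ⟨hne, huI⟩ := Finset.mem_erase.1 hu
    refine ⟨hY.2 u huI hne, ?_⟩
    rcases H.rotate.rotate.lt_or_gt huI hX.1 hne with b | b
    · exact (H.not_agree u huI X hX.1 (hX.2 u huI hne) (hY.2 u huI hne) b).elim
    · exact b
  exact H.pocket₂ X hX.1 x (Finset.mem_of_mem_erase hx) y (Finset.mem_of_mem_erase hy) z
    (Finset.mem_of_mem_erase hz) hxy hxz hyz (key x hx).1 (key x hx).2 (key y hy).1 (key y hy).2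
    (key z hz).1 (key z hz).2

/-- What it means for four points that no triple with `X` as the third point has full pockets. -/
theorem four_step (H : IsPocketSystem I f g h) (hno : ¬ HasPocketTriple I f g h) {X Y Z t : α}
    (hX : IsMaxPoint I f X) (hY : IsMaxPoint I g Y) (hZ : IsMaxPoint I h Z) (ht : t ∈ I)
    (hXY : X ≠ Y) (hXZ : X ≠ Z) (hYZ : Y ≠ Z) (htX : t ≠ X) (htY : t ≠ Y) (htZ : t ≠ Z)
    (hI : ∀ x ∈ I, x = X ∨ x = Y ∨ x = Z ∨ x = t) :
    (g t < g Z ∧ g Z < g X) ∨ (g t < g X ∧ g X < g Z ∧ f t < f Z ∧ f Z < f Y) ∨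
      (g Z < g X ∧ g X < g t ∧ f t < f Y) := by
  have hXI := hX.1
  have hYI := hY.1
  have hZI := hZ.1
  have fY := hX.2 Y hYI hXY.symm
  have fZ := hX.2 Z hZI hXZ.symm
  have ft := hX.2 t ht htX
  have gX := hY.2 X hXI hXY
  have gZ := hY.2 Z hZI hYZ.symm
  have gt := hY.2 t ht htY
  have hXl := hZ.2 X hXI hXZ
  have hYl := hZ.2 Y hYI hYZ
  have htl := hZ.2 t ht htZ
  have nmin : g Z < g X ∨ g t < g X := by
    by_contra hcon
    push Not at hcon
    refine H.pocket₁ X hXI Y hYI Z hZI t ht hYZ htY.symm htZ.symm fY gX fZ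
      (lt_of_le_of_ne hcon.1 fun e => hXZ (H.injOn₂ hXI hZI e)) ft
      (lt_of_le_of_ne hcon.2 fun e => htX (H.injOn₂ ht hXI e.symm))
  have cover : ∀ p q r : α,
      (∀ x, (x = X ∨ x = Y ∨ x = Z ∨ x = t) → x ≠ p → x ≠ q → x ≠ r →
      (f x < f p ∧ g p < g x) ∨ (g x < g q ∧ h q < h x) ∨ (h x < h r ∧ f r < f x)) →
      ∀ x ∈ I, x ≠ p → x ≠ q → x ≠ r →
      (f x < f p ∧ g p < g x) ∨ (g x < g q ∧ h q < h x) ∨ (h x < h r ∧ f r < f x) :=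
    fun p q r hc x hx => hc x (hI x hx)
  have below : ∀ x ∈ I, f x < f X → g x < g X → h X < h x := by
    intro x hx h1 h2
    have hne : x ≠ X := by rintro rfl; exact lt_irrefl _ h1
    rcases H.rotate.rotate.lt_or_gt hx hXI hne with b | b
    · exact (H.not_agree x hx X hXI h1 h2 b).elim
    · exact b
  have gZt := H.rotate.lt_or_gt hZI ht htZ.symm
  have gZX := H.rotate.lt_or_gt hZI hXI hXZ.symm
  have gtX := H.rotate.lt_or_gt ht hXI htX
  have fZt := H.lt_or_gt hZI ht htZ.symm
  have fZY := H.lt_or_gt hZI hYI hYZ.symm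
  have ftY := H.lt_or_gt ht hYI htY
  -- The candidates are the triples `(Y, t, X)`, `(Z, t, X)` and `(t, Z, X)`. The three alternatives
  -- of the goal describe, in this order, how the remaining point can escape their pockets.
  by_contra hcon
  apply hno
  rcases gtX with b1 | b1
  · rcases gZX with b2 | b2
    · have b3 : g Z < g t := by
        rcases gZt with b | b
        · exact b
        · exact absurd (Or.inl ⟨b, b2⟩) hcon
      refine ⟨Y, hYI, t, ht, X, hXI, fY, gt, below t ht ft b1, cover _ _ _ ?_⟩
      rintro x (rfl | rfl | rfl | rfl) n1 n2 n3
      · exact absurd rfl n3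
      · exact absurd rfl n1
      · exact Or.inr (Or.inl ⟨b3, htl⟩)
      · exact absurd rfl n2
    · have b3 : f Y < f Z := by
        rcases fZY with b | b
        · refine absurd (Or.inr (Or.inl ⟨b1, b2, ?_, b⟩)) hcon
          rcases fZt with b' | b'
          · exact (H.pocket₃ Z hZI X hXI Y hYI t ht hXY htX.symm htY.symm hXl fZ hYl b htl b').elim
          · exact b'
        · exact b
      refine ⟨Z, hZI, t, ht, X, hXI, fZ, b1.trans b2, below t ht ft b1, cover _ _ _ ?_⟩
      rintro x (rfl | rfl | rfl | rfl) n1 n2 n3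
      · exact absurd rfl n3
      · exact Or.inl ⟨b3, gZ⟩
      · exact absurd rfl n1
      · exact absurd rfl n2
  · have b2 : g Z < g X := by
      rcases nmin with b | b
      · exact b
      · exact absurd b (not_lt.2 b1.le)
    have b3 : f Y < f t := by
      rcases ftY with b | b
      · exact absurd (Or.inr (Or.inr ⟨b2, b1, b⟩)) hcon
      · exact b
    refine ⟨t, ht, Z, hZI, X, hXI, ft, b2.trans b1, hXl, cover _ _ _ ?_⟩
    rintro x (rfl | rfl | rfl | rfl) n1 n2 n3
    · exact absurd rfl n3
    · exact Or.inl ⟨b3, gt⟩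
    · exact absurd rfl n2
    · exact absurd rfl n1

theorem triple_of_four (H : IsPocketSystem I f g h) (h4 : I.card = 4) :
    HasPocketTriple I f g h := by
  classical
  by_contra hno
  have hne : I.Nonempty := by rw [← Finset.card_pos]; omega
  obtain ⟨X, hX⟩ := H.exists_isMaxPoint hne
  obtain ⟨Y, hY⟩ := H.rotate.exists_isMaxPoint hne
  obtain ⟨Z, hZ⟩ := H.rotate.rotate.exists_isMaxPoint hne
  have hXY := H.maxPoint_ne_maxPoint h4.ge hX hY
  have hYZ := H.rotate.maxPoint_ne_maxPoint h4.ge hY hZ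
  have hZX := H.rotate.rotate.maxPoint_ne_maxPoint h4.ge hZ hX
  have h3 : ({X, Y, Z} : Finset α).card = 3 :=
    Finset.card_eq_three.2 ⟨X, Y, Z, hXY, hZX.symm, hYZ, rfl⟩
  have hsub : ({X, Y, Z} : Finset α) ⊆ I := by
    simp [Finset.insert_subset_iff, hX.1, hY.1, hZ.1]
  have h1 : (I \ {X, Y, Z}).card = 1 := by
    rw [Finset.card_sdiff_of_subset hsub]; omega
  obtain ⟨t, ht⟩ := Finset.card_eq_one.1 h1
  have hmem : ∀ x, x ∈ I \ {X, Y, Z} ↔ x = t := fun x => by rw [ht, Finset.mem_singleton]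
  simp only [Finset.mem_sdiff, Finset.mem_insert, Finset.mem_singleton, not_or] at hmem
  obtain ⟨htI, htX, htY, htZ⟩ := (hmem t).2 rfl
  have hI : ∀ x ∈ I, x = X ∨ x = Y ∨ x = Z ∨ x = t := by
    intro x hx
    have := (hmem x).1
    tauto
  -- The failures for the three choices of the third point are incompatible once `t` may not be
  -- below `X`, `Y` or `Z` in all three orders.
  have s1 := H.four_step hno hX hY hZ htI hXY hZX.symm hYZ htX htY htZ hI
  have s2 := H.rotate.four_step (fun G => hno G.rotate) hY hZ hX htI hYZ hXY.symm hZX htY htZ htX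
    (fun x hx => by have := hI x hx; tauto)
  have s3 := H.rotate.rotate.four_step (fun G => hno G.rotate.rotate) hZ hX hY htI hZX hYZ.symm
    hXY htZ htX htY (fun x hx => by have := hI x hx; tauto)
  have n1 := H.not_agree t htI X hX.1 (hX.2 t htI htX)
  have n2 := fun a => H.not_agree t htI Y hY.1 a (hY.2 t htI htY)
  have n3 := fun a b => H.not_agree t htI Z hZ.1 a b (hZ.2 t htI htZ)
  grind

/-- What it means for five points that no pocket contains three points. -/
theorem five_step (H : IsPocketSystem I f g h) {X Y Z s t : α}
    (hX : IsMaxPoint I f X) (hY : IsMaxPoint I g Y) (hZ : Z ∈ I) (hs : s ∈ I) (ht : t ∈ I)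
    (hXY : X ≠ Y) (hXZ : X ≠ Z) (hYZ : Y ≠ Z) (hsX : s ≠ X) (hsY : s ≠ Y) (hsZ : s ≠ Z)
    (htX : t ≠ X) (htY : t ≠ Y) (htZ : t ≠ Z) (hst : s ≠ t) :
    (g X < g Z ∧ g s < g X ∧ g t < g X) ∨ (g Z < g X ∧ g X < g s ∧ g t < g X) ∨
      (g Z < g X ∧ g s < g X ∧ g X < g t) := by
  have hXI := hX.1
  -- One pocket of `X` already contains `Y`, so at most one of `Z`, `s`, `t` fits in; the other
  -- pocket cannot take all three. Hence exactly one of them is above `X` in `g`.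
  have above := H.pocket₁ X hXI Y hY.1
  have fY := hX.2 Y hY.1 hXY.symm
  have gX := hY.2 X hXI hXY
  have below : ∀ x ∈ I, x ≠ X → g x < g X → h X < h x := by
    intro x hx hne h2
    rcases H.rotate.rotate.lt_or_gt hx hXI hne with b | b
    · exact (H.not_agree x hx X hXI (hX.2 x hx hne) h2 b).elim
    · exact b
  have a1 : g X < g Z → g X < g s → False := fun c1 c2 =>
    above Z hZ s hs hYZ hsY.symm hsZ.symm fY gX (hX.2 Z hZ hXZ.symm) c1 (hX.2 s hs hsX) c2
  have a2 : g X < g Z → g X < g t → False := fun c1 c2 =>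
    above Z hZ t ht hYZ htY.symm htZ.symm fY gX (hX.2 Z hZ hXZ.symm) c1 (hX.2 t ht htX) c2
  have a3 : g X < g s → g X < g t → False := fun c1 c2 =>
    above s hs t ht hsY.symm htY.symm hst fY gX (hX.2 s hs hsX) c1 (hX.2 t ht htX) c2
  have a4 : g Z < g X → g s < g X → g t < g X → False := fun c1 c2 c3 =>
    H.pocket₂ X hXI Z hZ s hs t ht hsZ.symm htZ.symm hst c1 (below Z hZ hXZ.symm c1) c2
      (below s hs hsX c2) c3 (below t ht htX c3)
  have e1 := H.rotate.lt_or_gt hZ hXI hXZ.symm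
  have e2 := H.rotate.lt_or_gt hs hXI hsX
  have e3 := H.rotate.lt_or_gt ht hXI htX
  grind

/-- The triple is `(s, t, X)`: the pocket of `s` takes `Y` and that of `t` takes `Z`. -/
theorem five_finish (H : IsPocketSystem I f g h) {X Y Z s t : α}
    (hX : IsMaxPoint I f X) (hY : IsMaxPoint I g Y) (hZ : IsMaxPoint I h Z) (hs : s ∈ I)
    (ht : t ∈ I) (hXY : X ≠ Y) (hXZ : X ≠ Z) (hsX : s ≠ X) (hsY : s ≠ Y)
    (htX : t ≠ X) (htZ : t ≠ Z) (hI : ∀ x ∈ I, x = X ∨ x = Y ∨ x = Z ∨ x = s ∨ x = t)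
    (h1 : f Y < f Z) (h2 : g X < g s) (h3 : g t < g X) (h4 : f Z < f s) (h5 : f t < f Z) :
    HasPocketTriple I f g h := by
  have htX' : h X < h t := by
    rcases H.rotate.rotate.lt_or_gt ht hX.1 htX with b | b
    · exact (H.not_agree t ht X hX.1 (hX.2 t ht htX) h3 b).elim
    · exact b
  have hZt : g Z < g t := by
    rcases H.rotate.lt_or_gt ht hZ.1 htZ with b | b
    · exact (H.not_agree t ht Z hZ.1 h5 b (hZ.2 t ht htZ)).elim
    · exact b
  refine ⟨s, hs, t, ht, X, hX.1, hX.2 s hs hsX, h3.trans h2, htX', fun x hx n1 n2 n3 => ?_⟩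
  rcases hI x hx with rfl | rfl | rfl | rfl | rfl
  · exact absurd rfl n3
  · exact Or.inl ⟨h1.trans h4, hY.2 s hs hsY⟩
  · exact Or.inr (Or.inl ⟨hZt, hZ.2 t ht htZ⟩)
  · exact absurd rfl n1
  · exact absurd rfl n2

theorem triple_of_five (H : IsPocketSystem I f g h) (h5 : I.card = 5) :
    HasPocketTriple I f g h := by
  classical
  have hne : I.Nonempty := by rw [← Finset.card_pos]; omega
  obtain ⟨X, hX⟩ := H.exists_isMaxPoint hne
  obtain ⟨Y, hY⟩ := H.rotate.exists_isMaxPoint hne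
  obtain ⟨Z, hZ⟩ := H.rotate.rotate.exists_isMaxPoint hne
  have hXY := H.maxPoint_ne_maxPoint (by omega) hX hY
  have hYZ := H.rotate.maxPoint_ne_maxPoint (by omega) hY hZ
  have hZX := H.rotate.rotate.maxPoint_ne_maxPoint (by omega) hZ hX
  have h3 : ({X, Y, Z} : Finset α).card = 3 :=
    Finset.card_eq_three.2 ⟨X, Y, Z, hXY, hZX.symm, hYZ, rfl⟩
  have hsub : ({X, Y, Z} : Finset α) ⊆ I := by
    simp [Finset.insert_subset_iff, hX.1, hY.1, hZ.1]
  have h1 : (I \ {X, Y, Z}).card = 2 := by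
    rw [Finset.card_sdiff_of_subset hsub]; omega
  obtain ⟨s, t, hst, hmem'⟩ := Finset.card_eq_two.1 h1
  have hmem : ∀ x, x ∈ I \ {X, Y, Z} ↔ x = s ∨ x = t := fun x => by
    rw [hmem', Finset.mem_insert, Finset.mem_singleton]
  simp only [Finset.mem_sdiff, Finset.mem_insert, Finset.mem_singleton, not_or] at hmem
  obtain ⟨hs, hsX, hsY, hsZ⟩ := (hmem s).2 (Or.inl rfl)
  obtain ⟨ht, htX, htY, htZ⟩ := (hmem t).2 (Or.inr rfl)
  have hI : ∀ x ∈ I, x = X ∨ x = Y ∨ x = Z ∨ x = s ∨ x = t := by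
    intro x hx
    have := (hmem x).1
    tauto
  have hI' : ∀ x ∈ I, x = X ∨ x = Y ∨ x = Z ∨ x = t ∨ x = s := fun x hx => by
    rcases hI x hx with h | h | h | h | h <;> simp [h]
  have hIr : ∀ x ∈ I, x = Y ∨ x = Z ∨ x = X ∨ x = s ∨ x = t := fun x hx => by
    rcases hI x hx with h | h | h | h | h <;> simp [h]
  have hIr' : ∀ x ∈ I, x = Y ∨ x = Z ∨ x = X ∨ x = t ∨ x = s := fun x hx => by
    rcases hI x hx with h | h | h | h | h <;> simp [h]
  have hIrr : ∀ x ∈ I, x = Z ∨ x = X ∨ x = Y ∨ x = s ∨ x = t := fun x hx => by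
    rcases hI x hx with h | h | h | h | h <;> simp [h]
  have hIrr' : ∀ x ∈ I, x = Z ∨ x = X ∨ x = Y ∨ x = t ∨ x = s := fun x hx => by
    rcases hI x hx with h | h | h | h | h <;> simp [h]
  have s1 := H.five_step hX hY hZ.1 hs ht hXY hZX.symm hYZ hsX hsY hsZ htX htY htZ hst
  have s2 := H.rotate.five_step hY hZ hX.1 hs ht hYZ hXY.symm hZX hsY hsZ hsX htY htZ htX hst
  have s3 := H.rotate.rotate.five_step hZ hX hY.1 hs ht hZX hYZ.symm hXY hsZ hsX hsY htZ htX htY hst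
  -- If `Z` were the point above `X` in `g`, both `s` and `t` would be below `Z` in `g` and in `h`;
  -- but `s3` puts one of them below `Z` in `f` as well.
  have gZX : g Z < g X := by
    rcases s1 with ⟨b, bs, bt⟩ | ⟨b, -⟩ | ⟨b, -⟩
    · have nZs := fun a b => H.not_agree s hs Z hZ.1 a b (hZ.2 s hs hsZ)
      have nZt := fun a b => H.not_agree t ht Z hZ.1 a b (hZ.2 t ht htZ)
      rcases s3 with ⟨-, -, c⟩ | ⟨-, -, c⟩ | ⟨-, c, -⟩
      · exact (nZt c (bt.trans b)).elim
      · exact (nZt c (bt.trans b)).elim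
      · exact (nZs c (bs.trans b)).elim
    · exact b
    · exact b
  have hXY' : h X < h Y := by
    rcases s2 with ⟨b, bs, bt⟩ | ⟨b, -⟩ | ⟨b, -⟩
    · have nXs := fun a b => H.not_agree s hs X hX.1 (hX.2 s hs hsX) a b
      have nXt := fun a b => H.not_agree t ht X hX.1 (hX.2 t ht htX) a b
      rcases s1 with ⟨-, -, c⟩ | ⟨-, -, c⟩ | ⟨-, c, -⟩
      · exact (nXt c (bt.trans b)).elim
      · exact (nXt c (bt.trans b)).elim
      · exact (nXs c (bs.trans b)).elim
    · exact b
    · exact b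
  have fYZ : f Y < f Z := by
    rcases s3 with ⟨b, bs, bt⟩ | ⟨b, -⟩ | ⟨b, -⟩
    · have nYs := fun a b => H.not_agree s hs Y hY.1 b (hY.2 s hs hsY) a
      have nYt := fun a b => H.not_agree t ht Y hY.1 b (hY.2 t ht htY) a
      rcases s2 with ⟨-, -, c⟩ | ⟨-, -, c⟩ | ⟨-, c, -⟩
      · exact (nYt c (bt.trans b)).elim
      · exact (nYt c (bt.trans b)).elim
      · exact (nYs c (bs.trans b)).elim
    · exact b
    · exact b
  replace s1 := s1.resolve_left fun c => lt_asymm c.1 gZX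
  replace s2 := s2.resolve_left fun c => lt_asymm c.1 hXY'
  replace s3 := s3.resolve_left fun c => lt_asymm c.1 fYZ
  -- Each of `s1`, `s2`, `s3` now singles out `s` or `t`. Two of them single out the same point, and
  -- a rotation of `five_finish` applies to those two.
  rcases s1 with ⟨-, a1, a2⟩ | ⟨-, a1, a2⟩ <;> rcases s3 with ⟨-, c1, c2⟩ | ⟨-, c1, c2⟩
  · exact H.five_finish hX hY hZ hs ht hXY hZX.symm hsX hsY htX htZ hI fYZ a1 a2 c1 c2
  · rcases s2 with ⟨-, b1, b2⟩ | ⟨-, b1, b2⟩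
    · exact (H.rotate.five_finish hY hZ hX hs ht hYZ hXY.symm hsY hsZ htY htX hIr gZX b1 b2
        a1 a2).rotate
    · exact (H.rotate.rotate.five_finish hZ hX hY ht hs hZX hYZ.symm htZ htX hsZ hsY hIrr' hXY'
        c2 c1 b2 b1).rotate.rotate
  · rcases s2 with ⟨-, b1, b2⟩ | ⟨-, b1, b2⟩
    · exact (H.rotate.rotate.five_finish hZ hX hY hs ht hZX hYZ.symm hsZ hsX htZ htY hIrr hXY'
        c1 c2 b1 b2).rotate.rotate
    · exact (H.rotate.five_finish hY hZ hX ht hs hYZ hXY.symm htY htZ hsY hsX hIr' gZX b2 b1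
        a2 a1).rotate
  · exact H.five_finish hX hY hZ ht hs hXY hZX.symm htX htY hsX hsZ hI' fYZ a2 a1 c2 c1

theorem hasPocketTriple (H : IsPocketSystem I f g h) (h3 : 3 ≤ I.card) :
    HasPocketTriple I f g h := by
  classical
  have hne : I.Nonempty := by rw [← Finset.card_pos]; omega
  obtain ⟨X, hX⟩ := H.exists_isMaxPoint hne
  -- Every point other than the maximum `X` of `f` lies in one of two pockets of `X`, each with at
  -- most two points.
  have hle : I.card ≤ 5 := by
    have three : ∀ J ⊆ I, (∀ x ∈ J, f x < f X ∧ g X < g x) → J.card ≤ 2 := by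
      intro J hJ hall
      by_contra hcon
      obtain ⟨x, y, z, hx, hy, hz, hxy, hxz, hyz⟩ := Finset.two_lt_card_iff.1 (not_le.1 hcon)
      exact H.pocket₁ X hX.1 x (hJ hx) y (hJ hy) z (hJ hz) hxy hxz hyz (hall x hx).1 (hall x hx).2
        (hall y hy).1 (hall y hy).2 (hall z hz).1 (hall z hz).2
    have three' : ∀ J ⊆ I, (∀ x ∈ J, g x < g X ∧ h X < h x) → J.card ≤ 2 := by
      intro J hJ hall
      by_contra hcon
      obtain ⟨x, y, z, hx, hy, hz, hxy, hxz, hyz⟩ := Finset.two_lt_card_iff.1 (not_le.1 hcon)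
      exact H.pocket₂ X hX.1 x (hJ hx) y (hJ hy) z (hJ hz) hxy hxz hyz (hall x hx).1 (hall x hx).2
        (hall y hy).1 (hall y hy).2 (hall z hz).1 (hall z hz).2
    have c1 := three ((I.erase X).filter fun x => g X < g x)
      ((Finset.filter_subset _ _).trans (Finset.erase_subset _ _)) (by
        intro x hx
        obtain ⟨hx, hlt⟩ := Finset.mem_filter.1 hx
        exact ⟨hX.2 x (Finset.mem_of_mem_erase hx) (Finset.ne_of_mem_erase hx), hlt⟩)
    have c2 := three' ((I.erase X).filter fun x => ¬ g X < g x)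
      ((Finset.filter_subset _ _).trans (Finset.erase_subset _ _)) (by
        intro x hx
        obtain ⟨hx, hlt⟩ := Finset.mem_filter.1 hx
        have hxI := Finset.mem_of_mem_erase hx
        have hxX := Finset.ne_of_mem_erase hx
        have b : g x < g X := (H.rotate.lt_or_gt hxI hX.1 hxX).resolve_right hlt
        refine ⟨b, (H.rotate.rotate.lt_or_gt hxI hX.1 hxX).resolve_left fun c => ?_⟩
        exact H.not_agree x hxI X hX.1 (hX.2 x hxI hxX) b c)
    have := Finset.card_filter_add_card_filter_not (s := I.erase X) (fun x => g X < g x)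
    rw [Finset.card_erase_of_mem hX.1] at this
    omega
  have hcases : I.card = 3 ∨ I.card = 4 ∨ I.card = 5 := by omega
  rcases hcases with hc | hc | hc
  · have h2 : (I.erase X).card = 2 := by
      rw [Finset.card_erase_of_mem hX.1]; omega
    obtain ⟨s, t, hst, hmem⟩ := Finset.card_eq_two.1 h2
    have hs : s ∈ I.erase X := by simp [hmem]
    have ht : t ∈ I.erase X := by simp [hmem]
    have hI : ∀ x ∈ I, x = X ∨ x = s ∨ x = t := by
      intro x hx
      by_cases hxX : x = X
      · exact Or.inl hxX
      · have : x ∈ I.erase X := Finset.mem_erase.2 ⟨hxX, hx⟩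
        rw [hmem, Finset.mem_insert, Finset.mem_singleton] at this
        exact Or.inr this
    obtain ⟨hsX, hs⟩ := Finset.mem_erase.1 hs
    obtain ⟨htX, ht⟩ := Finset.mem_erase.1 ht
    rcases H.rotate.lt_or_gt hs ht hst with b | b
    · exact H.triple_of_three hX hs ht hsX htX hI b
    · exact H.triple_of_three hX ht hs htX hsX (fun x hx => by have := hI x hx; tauto) b
  · exact H.triple_of_four hc
  · exact H.triple_of_five hc

end IsPocketSystem

/-! ### Angular orders in a minimal triangle. -/

/-- The position of `x` in the order in which a ray that rotates about `A`, from `B` towards `C`,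
meets the points inside the triangle `A B C`. -/
noncomputable def angularPosition (A B C x : Plane) : ℝ := orient A B x / orient C A x

theorem angularPosition_lt_iff {A B C x y : Plane} (hx : InTri A B C x) (hy : InTri A B C y) :
    angularPosition A B C x < angularPosition A B C y ↔ 0 < orient A x y := by
  unfold angularPosition
  rw [div_lt_div_iff₀ hx.2.2 hy.2.2]
  have e : orient A B C * orient A x y =
      orient A B y * orient C A x - orient A B x * orient C A y := by
    unfold orient; ring
  rw [← mul_pos_iff_of_pos_left hx.orient_pos, e, sub_pos]

theorem angularPosition_ne {S : Finset Plane} (hS : InGeneralPosition S) {A B C x y : Plane}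
    (hA : A ∈ S) (hxS : x ∈ S) (hyS : y ∈ S) (hx : InTri A B C x) (hy : InTri A B C y)
    (hxy : x ≠ y) : angularPosition A B C x ≠ angularPosition A B C y := by
  have hAx : A ≠ x := by rintro rfl; simpa using hx.1
  have hAy : A ≠ y := by rintro rfl; simpa using hy.1
  rcases lt_or_gt_of_ne (hS.orient_ne_zero hA hxS hyS hAx hxy hAy) with h | h
  · refine ((angularPosition_lt_iff hy hx).2 ?_).ne'
    rw [orient_swap_right]; linarith
  · exact ((angularPosition_lt_iff hx hy).2 h).ne

theorem InTri.subtriangle {A B C p x : Plane} (hp : InTri A B C p) (hx : InTri A B p x) :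
    InTri A B C x := by
  have hD := hx.orient_pos
  have hABC : 0 < orient A B C := hp.orient_pos
  refine ⟨hx.1, ?_, ?_⟩
  · have e : orient B C x * orient A B p = orient B p x * orient A B C +
        orient A B x * orient B C p := by
      unfold orient; ring
    have : 0 < orient B C x * orient A B p := by
      rw [e]; exact add_pos (mul_pos hx.2.1 hABC) (mul_pos hx.1 hp.2.1)
    exact (mul_pos_iff_of_pos_right hD).1 this
  · have e : orient C A x * orient A B p = orient p A x * orient A B C +
        orient A B x * orient C A p := by
      unfold orient; ring
    have : 0 < orient C A x * orient A B p := by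
      rw [e]; exact add_pos (mul_pos hx.2.2 hABC) (mul_pos hx.1 hp.2.2)
    exact (mul_pos_iff_of_pos_right hD).1 this

theorem triPoints_rotate (S : Finset Plane) (A B C : Plane) :
    triPoints S B C A = triPoints S A B C := by
  ext x
  simp only [mem_triPoints, InTri]
  tauto

/-- In a triangle with at least three points inside that is minimal in this respect, the pocket of a
point contains at most two points. -/
theorem no_three_in_pocket {S : Finset Plane} {A B C : Plane} (hA : A ∈ S) (hB : B ∈ S)
    (hmin : ∀ a ∈ S, ∀ b ∈ S, ∀ c ∈ S, 3 ≤ (triPoints S a b c).card →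
      (triPoints S A B C).card ≤ (triPoints S a b c).card) :
    ∀ p ∈ triPoints S A B C, ∀ x ∈ triPoints S A B C, ∀ y ∈ triPoints S A B C,
    ∀ z ∈ triPoints S A B C, x ≠ y → x ≠ z → y ≠ z →
    angularPosition A B C x < angularPosition A B C p →
    angularPosition B C A p < angularPosition B C A x →
    angularPosition A B C y < angularPosition A B C p →
    angularPosition B C A p < angularPosition B C A y →
    angularPosition A B C z < angularPosition A B C p →
    angularPosition B C A p < angularPosition B C A z → False := by
  classical
  intro p hp x hx y hy z hz hxy hxz hyz x1 x2 y1 y2 z1 z2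
  obtain ⟨hpS, hpT⟩ := mem_triPoints.1 hp
  -- The pocket of `p` is the triangle `A B p`. It contains fewer points than `A B C` because it
  -- misses `p`, so three points in it contradict minimality.
  have mem : ∀ u ∈ triPoints S A B C, angularPosition A B C u < angularPosition A B C p →
      angularPosition B C A p < angularPosition B C A u → u ∈ triPoints S A B p := by
    intro u hu u1 u2
    obtain ⟨huS, huT⟩ := mem_triPoints.1 hu
    rw [angularPosition_lt_iff huT hpT] at u1
    rw [angularPosition_lt_iff hpT.rotate huT.rotate] at u2
    refine mem_triPoints.2 ⟨huS, huT.1, u2, ?_⟩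
    rwa [← orient_rotate]
  have h3 : 3 ≤ (triPoints S A B p).card :=
    Finset.two_lt_card_iff.2 ⟨x, y, z, mem x hx x1 x2, mem y hy y1 y2, mem z hz z1 z2, hxy, hxz, hyz⟩
  have hlt : (triPoints S A B p).card < (triPoints S A B C).card := by
    apply Finset.card_lt_card
    rw [Finset.ssubset_iff_of_subset]
    · refine ⟨p, hp, fun hh => ?_⟩
      simpa using (mem_triPoints.1 hh).2.2.1
    · intro u hu
      obtain ⟨huS, huT⟩ := mem_triPoints.1 hu
      exact mem_triPoints.2 ⟨huS, hpT.subtriangle huT⟩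
  exact absurd (hmin A hA B hB p hpS h3) (not_le.2 hlt)

/-- A triangle with at least three points inside contains an empty `6`-pseudo-triangle. -/
theorem hasEmptyPseudoTriangle_six {S : Finset Plane} (hS : InGeneralPosition S) {a b c : Plane}
    (ha : a ∈ S) (hb : b ∈ S) (hc : c ∈ S) (h3 : 3 ≤ (triPoints S a b c).card) :
    HasEmptyPseudoTriangle 6 S := by
  classical
  obtain ⟨⟨A, B, C⟩, hABC, hmin'⟩ := Finset.exists_min_image
    ((S ×ˢ S ×ˢ S).filter fun T => 3 ≤ (triPoints S T.1 T.2.1 T.2.2).card)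
    (fun T => (triPoints S T.1 T.2.1 T.2.2).card)
    ⟨(a, b, c), by simp [ha, hb, hc, h3]⟩
  simp only [Finset.mem_filter, Finset.mem_product] at hABC hmin'
  obtain ⟨⟨hA, hB, hC⟩, hcard⟩ := hABC
  have hmin : ∀ a ∈ S, ∀ b ∈ S, ∀ c ∈ S, 3 ≤ (triPoints S a b c).card →
      (triPoints S A B C).card ≤ (triPoints S a b c).card :=
    fun a ha b hb c hc h => hmin' (a, b, c) ⟨⟨ha, hb, hc⟩, h⟩
  have r1 := triPoints_rotate S A B C
  have r2 := (triPoints_rotate S B C A).trans r1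
  have hsys : IsPocketSystem (triPoints S A B C) (angularPosition A B C) (angularPosition B C A)
      (angularPosition C A B) := by
    refine ⟨?_, ?_, ?_, ?_, no_three_in_pocket hA hB hmin, ?_, ?_⟩
    · intro x hx y hy e
      obtain ⟨hxS, hxT⟩ := mem_triPoints.1 (Finset.mem_coe.1 hx)
      obtain ⟨hyS, hyT⟩ := mem_triPoints.1 (Finset.mem_coe.1 hy)
      by_contra hne
      exact angularPosition_ne hS hA hxS hyS hxT hyT hne e
    · intro x hx y hy e
      obtain ⟨hxS, hxT⟩ := mem_triPoints.1 (Finset.mem_coe.1 hx)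
      obtain ⟨hyS, hyT⟩ := mem_triPoints.1 (Finset.mem_coe.1 hy)
      by_contra hne
      exact angularPosition_ne hS hB hxS hyS hxT.rotate hyT.rotate hne e
    · intro x hx y hy e
      obtain ⟨hxS, hxT⟩ := mem_triPoints.1 (Finset.mem_coe.1 hx)
      obtain ⟨hyS, hyT⟩ := mem_triPoints.1 (Finset.mem_coe.1 hy)
      by_contra hne
      exact angularPosition_ne hS hC hxS hyS hxT.rotate.rotate hyT.rotate.rotate hne e
    · intro x hx y hy h1 h2 h3
      have hxT := (mem_triPoints.1 hx).2
      have hyT := (mem_triPoints.1 hy).2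
      rw [angularPosition_lt_iff hxT hyT] at h1
      rw [angularPosition_lt_iff hxT.rotate hyT.rotate] at h2
      rw [angularPosition_lt_iff hxT.rotate.rotate hyT.rotate.rotate] at h3
      -- The coefficients are the barycentric weights of `x`, so the sum is a multiple of `orient x
      -- x y = 0`; its three terms cannot all be positive.
      have e : orient B C x * orient A x y + orient C A x * orient B x y +
          orient A B x * orient C x y = 0 := by
        unfold orient; ring
      linarith [mul_pos hxT.2.1 h1, mul_pos hxT.2.2 h2, mul_pos hxT.1 h3]
    · have := no_three_in_pocket (C := A) hB hC (by rw [r1]; exact hmin)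
      rwa [r1] at this
    · have := no_three_in_pocket (C := B) hC hA (by rw [r2]; exact hmin)
      rwa [r2] at this
  obtain ⟨p, hp, q, hq, r, hr, h1, h2, h3, hall⟩ := hsys.hasPocketTriple hcard
  obtain ⟨hpS, hpT⟩ := mem_triPoints.1 hp
  obtain ⟨hqS, hqT⟩ := mem_triPoints.1 hq
  obtain ⟨hrS, hrT⟩ := mem_triPoints.1 hr
  rw [angularPosition_lt_iff hpT hrT] at h1
  rw [angularPosition_lt_iff hqT.rotate hpT.rotate] at h2
  rw [angularPosition_lt_iff hrT.rotate.rotate hqT.rotate.rotate] at h3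
  have hstar : IsStar A p B q C r := ⟨hpT, hqT, hrT, h1, h2, h3⟩
  refine hstar.hasEmptyPseudoTriangle hA hpS hB hqS hC hrS fun x hx hxT nxp nxq nxr => ?_
  have := hall x (mem_triPoints.2 ⟨hx, hxT⟩) nxp nxq nxr
  rw [angularPosition_lt_iff hxT hpT, angularPosition_lt_iff hpT.rotate hxT.rotate,
    angularPosition_lt_iff hxT.rotate hqT.rotate,
    angularPosition_lt_iff hqT.rotate.rotate hxT.rotate.rotate,
    angularPosition_lt_iff hxT.rotate.rotate hrT.rotate.rotate,
    angularPosition_lt_iff hrT hxT] at this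
  rw [← orient_rotate p A x, ← orient_rotate q B x, ← orient_rotate r C x]
  tauto

/-! ### Convex vertices of simple polygons and hulls of pseudo-triangles. -/

namespace Polygon

variable {n : ℕ} {P : Polygon Plane n}

theorem mem_edgeSet_iff {i : Fin n} {x : Plane} :
    x ∈ P.edgeSet ℝ i ↔ x ∈ segment ℝ (P i) (P (finRotate n i)) := by
  rw [Polygon.edgeSet, affineSegment_eq_segment]

theorem isClosed_edgeSet (i : Fin n) : IsClosed (P.edgeSet ℝ i) := by
  rw [Polygon.edgeSet, affineSegment_eq_segment, ← convexHull_pair]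
  exact (Set.toFinite _).isClosed_convexHull ℝ

/-- Near a vertex of a simple polygon there is no edge other than the two edges at this vertex. -/
theorem IsSimple.exists_ball (hP : P.IsSimple) (i : Fin n) :
    ∃ ε > 0, ∀ j, j ≠ i → finRotate n j ≠ i → ∀ x ∈ P.edgeSet ℝ j, ε ≤ dist x (P i) := by
  have hcl : IsClosed (⋃ j ∈ {j : Fin n | j ≠ i ∧ finRotate n j ≠ i}, P.edgeSet ℝ j) :=
    (Set.toFinite _).isClosed_biUnion fun j _ => isClosed_edgeSet j
  have hv : P i ∉ ⋃ j ∈ {j : Fin n | j ≠ i ∧ finRotate n j ≠ i}, P.edgeSet ℝ j := by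
    simp only [Set.mem_iUnion, not_exists]
    rintro j ⟨hj1, hj2⟩ hmem
    rcases hP.2.2 i j hj1.symm (P i) ⟨mem_edgeSet_iff.2 (left_mem_segment ℝ _ _), hmem⟩ with h | h
    · exact hj1 (hP.2.1 h.2).symm
    · exact hj2 h.1.symm
  obtain ⟨ε, hε, hball⟩ := Metric.isOpen_iff.1 hcl.isOpen_compl (P i) hv
  refine ⟨ε, hε, fun j hj1 hj2 x hx => ?_⟩
  by_contra hcon
  refine hball (Metric.mem_ball.2 (not_le.1 hcon)) ?_
  exact Set.mem_biUnion (show j ∈ {j : Fin n | j ≠ i ∧ finRotate n j ≠ i} from ⟨hj1, hj2⟩) hx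

/-- A vertex of the convex hull of a simple polygon is a convex vertex of the polygon. -/
theorem IsSimple.isConvexVertex_of_mem_extremePoints (hP : P.IsSimple) {i : Fin n}
    (hext : P i ∈ (convexHull ℝ (Set.range P.vertices)).extremePoints ℝ)
    (hD : orient (P i) (P ((finRotate n).symm i)) (P (finRotate n i)) ≠ 0) :
    P.IsConvexVertex i := by
  set v := P i with hv
  set u := P ((finRotate n).symm i) with hu
  set w := P (finRotate n i) with hw
  set D := orient v u w with hDdef
  -- a line that supports the convex hull at `v`
  obtain ⟨f, s, hfs, hfall⟩ := geometric_hahn_banach_point_closed (convex_convexHull ℝ _)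
    (((Set.finite_range P.vertices).subset
      (Set.sdiff_subset (t := {v}))).isClosed_convexHull ℝ)
    (notMem_convexHull_sdiff_of_mem_extremePoints (convex_convexHull ℝ _)
      (subset_convexHull ℝ (Set.range P.vertices)) hext)
  have hfv : ∀ j, f v ≤ f (P j) := by
    intro j
    by_cases hj : P j = v
    · rw [hj]
    · exact (hfs.trans (hfall _ (subset_convexHull ℝ _ ⟨⟨j, rfl⟩, hj⟩))).le
  have hfne : ∀ j, P j ≠ v → f v < f (P j) := fun j hj =>
    hfs.trans (hfall _ (subset_convexHull ℝ _ ⟨⟨j, rfl⟩, hj⟩))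
  have huv : u ≠ v := by
    intro e; rw [hDdef, e] at hD; simp at hD
  have hwv : w ≠ v := by
    intro e; rw [hDdef, e] at hD; simp at hD
  have hfu : f v < f u := hfne _ huv
  have hfw : f v < f w := hfne _ hwv
  have hfb : ∀ z ∈ P.boundary ℝ, f v ≤ f z := by
    intro z hz
    obtain ⟨j, hj⟩ := Set.mem_iUnion.1 hz
    obtain ⟨a, b, ha, hb, hab, rfl⟩ := mem_edgeSet_iff.1 hj
    have h1 := mul_le_mul_of_nonneg_left (hfv j) ha
    have h2 := mul_le_mul_of_nonneg_left (hfv (finRotate n j)) hb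
    simp only [map_add, map_smul, smul_eq_mul]
    have : f v = a * f v + b * f v := by rw [← add_mul, hab, one_mul]
    linarith
  obtain ⟨ε₁, hε₁, hball⟩ := hP.exists_ball i
  -- the coordinates with respect to the two edges at `v`
  have coord : ∀ x, x = v + (orient v x w / D) • (u - v) + (orient v u x / D) • (w - v) := by
    intro x
    apply plane_ext <;>
      simp only [PiLp.add_apply, PiLp.smul_apply, PiLp.sub_apply, smul_eq_mul] <;>
      field_simp <;> rw [hDdef] <;> unfold orient <;> ring
  have hUopen : IsOpen {x | orient v x w / D < 1 ∧ orient v u x / D < 1} := by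
    have c1 : Continuous fun x => orient v x w / D := by
      unfold orient; fun_prop
    have c2 : Continuous fun x => orient v u x / D := by
      unfold orient; fun_prop
    exact (isOpen_lt c1 continuous_const).inter (isOpen_lt c2 continuous_const)
  obtain ⟨ε₂, hε₂, hball₂⟩ := Metric.isOpen_iff.1 hUopen v (by simp)
  refine ⟨min ε₁ ε₂, lt_min hε₁ hε₂, fun x hx hdist => ?_⟩
  have hd1 : dist x v < ε₁ := hdist.trans_le (min_le_left _ _)
  obtain ⟨lt1, lt2⟩ := hball₂ (Metric.mem_ball.2 (hdist.trans_le (min_le_right _ _)))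
  -- Suppose `x` is near `v` on the side of the line `v m` that contains neither edge at `v`. The
  -- half-ball on that side and the half-plane beyond the supporting line both avoid the boundary
  -- and overlap, so `x` lies in an unbounded component.
  have key : ∀ (c : ℝ) (m : Plane), 0 ≤ c * orient v m u → 0 ≤ c * orient v m w →
      0 < c * orient v m u + c * orient v m w → ¬ c * orient v m x < 0 := by
    intro c m hgu hgw hpos hneg
    let K : Set Plane := (Metric.ball v ε₁ ∩ {z | c * orient v m z < 0}) ∪ {z | f z < f v}
    -- A short step from `v` opposite to both edges lands in both parts of `K`, so their union is
    -- connected; the same direction later leads to infinity.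
    obtain ⟨δ, hδ, hyball⟩ : ∃ δ : ℝ, 0 < δ ∧
        v + δ • (-(u - v) - (w - v)) ∈ Metric.ball v ε₁ := by
      have hc : Continuous fun δ : ℝ => v + δ • (-(u - v) - (w - v)) := by fun_prop
      obtain ⟨η, hη, hη'⟩ := Metric.continuousAt_iff.1 (hc.continuousAt (x := 0)) ε₁ hε₁
      refine ⟨η / 2, by positivity, ?_⟩
      have := hη' (x := η / 2) (by simp [abs_of_pos hη, hη])
      simpa using this
    have hyg : c * orient v m (v + δ • (-(u - v) - (w - v))) < 0 := by
      have e : c * orient v m (v + δ • (-(u - v) - (w - v))) =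
          -(δ * (c * orient v m u + c * orient v m w)) := by
        simp only [orient, PiLp.add_apply, PiLp.smul_apply, PiLp.sub_apply, PiLp.neg_apply,
          smul_eq_mul]
        ring
      rw [e]
      have := mul_pos hδ hpos
      linarith
    have hyf : ∀ t : ℝ, 0 < t → f (v + t • (-(u - v) - (w - v))) < f v := by
      intro t ht
      simp only [map_add, map_smul, map_sub, map_neg, smul_eq_mul]
      nlinarith [mul_pos ht (sub_pos.2 hfu), mul_pos ht (sub_pos.2 hfw)]
    have hconv : Convex ℝ {z | c * orient v m z < 0} := by
      intro y hy z hz a b ha hb hab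
      simp only [Set.mem_ofPred_eq] at *
      rw [orient_combo v m y z hab]
      have : c * (a * orient v m y + b * orient v m z) =
          a * (c * orient v m y) + b * (c * orient v m z) := by ring
      rw [this]
      rcases ha.eq_or_lt with rfl | ha
      · obtain rfl : b = 1 := by linarith
        linarith
      · nlinarith [mul_neg_of_pos_of_neg ha hy, mul_nonneg hb (neg_nonneg.2 hz.le)]
    have hpre : IsPreconnected K :=
      IsPreconnected.union _ ⟨hyball, hyg⟩ (hyf δ hδ)
        ((convex_ball v ε₁).inter hconv).isPreconnected
        ((convex_halfSpace_lt f.toLinearMap.isLinear (f v)).isPreconnected)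
    have hKb : K ⊆ (P.boundary ℝ)ᶜ := by
      rintro z hz hzb
      rcases hz with ⟨hz1, hz2⟩ | hz
      · obtain ⟨j, hj⟩ := Set.mem_iUnion.1 hzb
        have hz2' : c * orient v m z < 0 := hz2
        have edge : ∀ {b₁ b₂ : Plane}, z ∈ segment ℝ b₁ b₂ → 0 ≤ c * orient v m b₁ →
            0 ≤ c * orient v m b₂ → False := by
          intro b₁ b₂ hzs h1 h2
          obtain ⟨a, b, ha, hb, -, -, e⟩ := mem_segment_orient hzs
          rw [e] at hz2'
          nlinarith [mul_nonneg ha h1, mul_nonneg hb h2]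
        by_cases hji : j = i
        · subst hji
          exact edge (mem_edgeSet_iff.1 hj) (by rw [← hv]; simp) hgw
        · by_cases hji' : finRotate n j = i
          · have hj' : j = (finRotate n).symm i := by rw [← hji', Equiv.symm_apply_apply]
            have hmem := mem_edgeSet_iff.1 hj
            rw [hji', hj'] at hmem
            exact edge hmem hgu (by rw [← hv]; simp)
          · exact absurd (hball j hji hji' z hj) (not_le.2 hz1)
      · exact absurd (hfb z hzb) (not_le.2 hz)
    have hsub : K ⊆ connectedComponentIn (P.boundary ℝ)ᶜ x :=
      hpre.subset_connectedComponentIn (Or.inl ⟨hd1, hneg⟩) hKb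
    obtain ⟨R, hR⟩ := (hx.2.subset hsub).subset_closedBall v
    set d := -(u - v) - (w - v) with hd
    have hd0 : d ≠ 0 := by
      intro e
      have := hyf 1 one_pos
      rw [e] at this
      simp at this
    have hd' : 0 < ‖d‖ := norm_pos_iff.2 hd0
    have hmem := hR (Or.inr (hyf ((|R| + 1) / ‖d‖) (by positivity)))
    simp only [Metric.mem_closedBall, dist_self_add_left, norm_smul, norm_div, Real.norm_eq_abs,
      abs_norm] at hmem
    rw [div_mul_cancel₀ _ hd'.ne', abs_of_pos (by positivity)] at hmem
    linarith [le_abs_self R]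
  have ha : 0 ≤ orient v x w / D := by
    have e₁ : -(1 / D) * orient v w u = 1 := by
      rw [orient_swap_right v u w, ← hDdef]
      field_simp
    have := key (-(1 / D)) w (by rw [e₁]; exact zero_le_one) (by simp) (by rw [e₁]; simp)
    rw [orient_swap_right v x w] at this
    have e : -(1 / D) * -orient v x w = orient v x w / D := by ring
    rw [e] at this
    exact not_lt.1 this
  have hb : 0 ≤ orient v u x / D := by
    have e₁ : 1 / D * orient v u w = 1 := one_div_mul_cancel hD
    have := key (1 / D) u (by simp) (by rw [e₁]; exact zero_le_one) (by rw [e₁]; simp)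
    have e : 1 / D * orient v u x = orient v u x / D := by ring
    rw [e] at this
    exact not_lt.1 this
  -- A vanishing coordinate would put `x` on an edge at `v`; that it is on the edge and not on its
  -- prolongation uses the bounds `lt1` and `lt2`.
  refine ⟨orient v x w / D, orient v u x / D, lt_of_le_of_ne ha fun e => hx.1 ?_,
    lt_of_le_of_ne hb fun e => hx.1 ?_, coord x⟩
  · refine Set.mem_iUnion.2 ⟨i, mem_edgeSet_iff.2 ?_⟩
    refine ⟨1 - orient v u x / D, orient v u x / D, by linarith, hb, by ring, ?_⟩
    conv_rhs => rw [coord x, ← e]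
    module
  · refine Set.mem_iUnion.2 ⟨(finRotate n).symm i, mem_edgeSet_iff.2 ?_⟩
    rw [Equiv.apply_symm_apply]
    refine ⟨orient v x w / D, 1 - orient v x w / D, ha, by linarith, by ring, ?_⟩
    conv_rhs => rw [coord x, ← e]
    module

end Polygon

/-- The convex hull of a `6`-pseudo-triangle is a triangle, with three vertices inside. -/
theorem exists_three_le_card_triPoints {S : Finset Plane} (hS : InGeneralPosition S)
    {P : Polygon Plane 6} (hPS : ∀ i, P i ∈ S) (hP : P.IsPseudoTriangle) :
    ∃ a ∈ S, ∃ b ∈ S, ∃ c ∈ S, 3 ≤ (triPoints S a b c).card := by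
  classical
  have hinj := hP.1.2.1
  have hne : ∀ i : Fin 6, i ≠ (finRotate 6).symm i ∧ (finRotate 6).symm i ≠ finRotate 6 i ∧
      i ≠ finRotate 6 i := by decide
  let V : Finset Plane := Finset.univ.image P.vertices
  have hVS : V ⊆ S := by
    intro x hx
    obtain ⟨i, -, rfl⟩ := Finset.mem_image.1 hx
    exact hPS i
  have hV6 : V.card = 6 := by
    rw [Finset.card_image_of_injective _ hinj]; simp
  have hVrange : (V : Set Plane) = Set.range P.vertices := by simp [V]
  have hext : (hullVertices V).card ≤ 3 := by
    have hsub : (hullVertices V : Set Plane) ⊆ P.vertices '' {i | P.IsConvexVertex i} := by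
      intro x hx
      rw [coe_hullVertices] at hx
      have hxV : x ∈ (V : Set Plane) := extremePoints_convexHull_subset hx
      rw [hVrange] at hxV hx
      obtain ⟨i, rfl⟩ := hxV
      refine ⟨i, hP.1.isConvexVertex_of_mem_extremePoints hx ?_, rfl⟩
      exact hS.orient_ne_zero (hPS _) (hPS _) (hPS _) (hinj.ne (hne i).1) (hinj.ne (hne i).2.1)
        (hinj.ne (hne i).2.2)
    have := Set.ncard_le_ncard hsub (Set.toFinite _)
    rw [Set.ncard_coe_finset] at this
    have h2 := Set.ncard_image_le (f := P.vertices) (s := {i | P.IsConvexVertex i}) (Set.toFinite _)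
    have h3 := hP.2
    omega
  by_contra hcon
  push Not at hcon
  have hle : ∀ a ∈ V, ∀ b ∈ V, ∀ c ∈ V, (triPoints V a b c).card ≤ 2 := by
    intro a ha b hb c hc
    have h1 := hcon a (hVS ha) b (hVS hb) c (hVS hc)
    have h2 : triPoints V a b c ⊆ triPoints S a b c := fun x hx =>
      mem_triPoints.2 ⟨hVS (mem_triPoints.1 hx).1, (mem_triPoints.1 hx).2⟩
    have := Finset.card_le_card h2
    omega
  -- The fan count for the six vertices would read 6 + 4 ≤ 3 · 3.
  have := card_le_of_card_triPoints_le (hS.mono hVS) (by omega) hle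
  omega

/-! ### A set of eleven points -/

/-- The first coordinates of the points of `elevenPoints`. -/
def elevenX : Fin 11 → ℤ := ![6, 9, 3, 2, 11, 1, 6, 0, 10, 11, 0]

/-- The second coordinates of the points of `elevenPoints`. -/
def elevenY : Fin 11 → ℤ := ![10, 11, 1, 3, 12, 4, 12, 4, 7, 7, 11]

/-- The orientation determinant of three of the points of `elevenPoints`. -/
def elevenOrient (i j k : Fin 11) : ℤ :=
  (elevenX j - elevenX i) * (elevenY k - elevenY i) -
    (elevenY j - elevenY i) * (elevenX k - elevenX i)

/-- The integer version of `InTri` for the points of `elevenPoints`. -/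
abbrev ElevenInTri (i j k d : Fin 11) : Prop :=
  0 < elevenOrient i j d ∧ 0 < elevenOrient j k d ∧ 0 < elevenOrient k i d

/-- The triangle with three given vertices, in either orientation, has none of the points of
`elevenPoints` inside. -/
def ElevenEmpty (i j k : Fin 11) : Prop :=
  ∀ d, ¬ ElevenInTri i j k d ∧ ¬ ElevenInTri i k j d

instance (i j k : Fin 11) : Decidable (ElevenEmpty i j k) :=
  inferInstanceAs (Decidable (∀ d, ¬ ElevenInTri i j k d ∧ ¬ ElevenInTri i k j d))

/-- The points of `elevenPoints`, enumerated. -/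
noncomputable def elevenPoint (i : Fin 11) : Plane := !₂[(elevenX i : ℝ), (elevenY i : ℝ)]

/-- Eleven points without `6`-holes and without triangles that have three of the points inside. -/
noncomputable def elevenPoints : Finset Plane :=
  Finset.univ.map ⟨elevenPoint, fun i j h => by
    have h0 := congrArg (fun p : Plane => p 0) h
    have h1 := congrArg (fun p : Plane => p 1) h
    simp only [elevenPoint, PiLp.toLp_apply, Matrix.cons_val_zero, Matrix.cons_val_one,
      Int.cast_inj] at h0 h1
    have key : ∀ i j, elevenX i = elevenX j → elevenY i = elevenY j → i = j := by decide +kernel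
    exact key i j h0 h1⟩

theorem mem_elevenPoints {x : Plane} : x ∈ elevenPoints ↔ ∃ i, elevenPoint i = x := by
  simp only [elevenPoints, Finset.mem_map, Finset.mem_univ, true_and]
  rfl

theorem elevenPoint_mem (i : Fin 11) : elevenPoint i ∈ elevenPoints :=
  mem_elevenPoints.2 ⟨i, rfl⟩

theorem card_elevenPoints : elevenPoints.card = 11 := by
  simp [elevenPoints]

theorem orient_elevenPoint (i j k : Fin 11) :
    orient (elevenPoint i) (elevenPoint j) (elevenPoint k) = elevenOrient i j k := by
  simp [orient, elevenPoint, elevenOrient]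

theorem inTri_elevenPoint {i j k d : Fin 11} :
    InTri (elevenPoint i) (elevenPoint j) (elevenPoint k) (elevenPoint d) ↔
      ElevenInTri i j k d := by
  simp only [InTri, orient_elevenPoint, Int.cast_pos]

theorem inGeneralPosition_elevenPoints : InGeneralPosition elevenPoints := by
  have key : ∀ i j k, i ≠ j → j ≠ k → i ≠ k → elevenOrient i j k ≠ 0 := by decide +kernel
  intro a ha b hb c hc hab hbc hac
  obtain ⟨i, rfl⟩ := mem_elevenPoints.1 ha
  obtain ⟨j, rfl⟩ := mem_elevenPoints.1 hb
  obtain ⟨k, rfl⟩ := mem_elevenPoints.1 hc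
  rw [collinear_iff_orient_eq_zero, orient_elevenPoint, Int.cast_eq_zero]
  exact key i j k (ne_of_apply_ne _ hab) (ne_of_apply_ne _ hbc) (ne_of_apply_ne _ hac)

theorem card_triPoints_elevenPoints_le {a b c : Plane} (ha : a ∈ elevenPoints)
    (hb : b ∈ elevenPoints) (hc : c ∈ elevenPoints) : (triPoints elevenPoints a b c).card ≤ 2 := by
  classical
  have key : ∀ i j k, (Finset.univ.filter (ElevenInTri i j k)).card ≤ 2 := by decide +kernel
  obtain ⟨i, rfl⟩ := mem_elevenPoints.1 ha
  obtain ⟨j, rfl⟩ := mem_elevenPoints.1 hb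
  obtain ⟨k, rfl⟩ := mem_elevenPoints.1 hc
  refine (Finset.card_le_card (t := (Finset.univ.filter (ElevenInTri i j k)).image elevenPoint)
    fun x hx => ?_).trans (Finset.card_image_le.trans (key i j k))
  obtain ⟨hx, hin⟩ := mem_triPoints.1 hx
  obtain ⟨d, rfl⟩ := mem_elevenPoints.1 hx
  exact Finset.mem_image_of_mem _ (Finset.mem_filter.2 ⟨Finset.mem_univ _, inTri_elevenPoint.1 hin⟩)

theorem not_hasEmptyPseudoTriangle_elevenPoints : ¬ HasEmptyPseudoTriangle 6 elevenPoints := by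
  rintro ⟨P, hPS, hP, -⟩
  obtain ⟨a, ha, b, hb, c, hc, h⟩ :=
    exists_three_le_card_triPoints inGeneralPosition_elevenPoints hPS hP
  have := card_triPoints_elevenPoints_le ha hb hc
  omega

set_option synthInstance.maxHeartbeats 400000 in
set_option synthInstance.maxSize 2000 in
/-- Any six of the eleven points have a triangle that is not empty. -/
theorem exists_not_elevenEmpty : ∀ i j, i < j → ∀ k, j < k → ElevenEmpty i j k →
    ∀ l, k < l → ElevenEmpty i j l → ElevenEmpty i k l → ElevenEmpty j k l →
    ∀ m, l < m → ElevenEmpty i j m → ElevenEmpty i k m → ElevenEmpty i l m → ElevenEmpty j k m →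
      ElevenEmpty j l m → ElevenEmpty k l m →
    ∀ n, m < n → ElevenEmpty i j n → ElevenEmpty i k n → ElevenEmpty i l n → ElevenEmpty i m n →
      ElevenEmpty j k n → ElevenEmpty j l n → ElevenEmpty j m n → ElevenEmpty k l n →
      ElevenEmpty k m n → ¬ ElevenEmpty l m n := by
  -- Each emptiness hypothesis stands right after the last index it involves, so a partial choice of
  -- points is abandoned at its first nonempty triangle.
  decide +kernel

/-- Convexity plays no role: the interior of a triangle of hole vertices lies in the interior of the
hole, so all these triangles are empty. Sorting the six indices brings them into the form of
`exists_not_elevenEmpty`. -/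
theorem not_hasHole_elevenPoints : ¬ HasHole 6 elevenPoints := by
  classical
  rintro ⟨T, hTS, hT6, -, hT⟩
  let I : Finset (Fin 11) := Finset.univ.filter fun i => elevenPoint i ∈ T
  have hI : 6 ≤ I.card := by
    rw [← hT6]
    refine (Finset.card_le_card (t := I.image elevenPoint) fun x hx => ?_).trans
      Finset.card_image_le
    obtain ⟨i, rfl⟩ := mem_elevenPoints.1 (hTS hx)
    exact Finset.mem_image_of_mem _ (Finset.mem_filter.2 ⟨Finset.mem_univ _, hx⟩)
  obtain ⟨J, hJI, hJ⟩ := Finset.exists_subset_card_eq hI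
  let g := J.orderEmbOfFin hJ
  have hg : ∀ r, elevenPoint (g r) ∈ convexHull ℝ (T : Set Plane) := fun r =>
    subset_convexHull ℝ _ (Finset.mem_filter.1 (hJI (Finset.orderEmbOfFin_mem J hJ r))).2
  have hlt : ∀ {r s : Fin 6}, r < s → g r < g s := fun h => g.strictMono h
  have hE : ∀ r s t, ElevenEmpty (g r) (g s) (g t) := fun r s t d =>
    ⟨fun h => hT _ (elevenPoint_mem d)
      ((inTri_elevenPoint.2 h).mem_interior_convexHull (hg r) (hg s) (hg t)),
     fun h => hT _ (elevenPoint_mem d)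
      ((inTri_elevenPoint.2 h).mem_interior_convexHull (hg r) (hg t) (hg s))⟩
  exact exists_not_elevenEmpty (g 0) (g 1) (hlt (by decide)) (g 2) (hlt (by decide)) (hE _ _ _)
    (g 3) (hlt (by decide)) (hE _ _ _) (hE _ _ _) (hE _ _ _)
    (g 4) (hlt (by decide)) (hE _ _ _) (hE _ _ _) (hE _ _ _) (hE _ _ _) (hE _ _ _) (hE _ _ _)
    (g 5) (hlt (by decide)) (hE _ _ _) (hE _ _ _) (hE _ _ _) (hE _ _ _) (hE _ _ _) (hE _ _ _)
    (hE _ _ _) (hE _ _ _) (hE _ _ _) (hE _ _ _)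

/-! ### The two bounds. -/

theorem eighteen_mem_holeOrPseudoTriangleSizes : 18 ∈ holeOrPseudoTriangleSizes 6 6 := by
  intro S hcard hS
  by_cases h : ∀ a ∈ S, ∀ b ∈ S, ∀ c ∈ S, (triPoints S a b c).card ≤ 2
  · exact Or.inl (hasHole_six_of_card_triPoints_le hS hcard h)
  · push Not at h
    obtain ⟨a, ha, b, hb, c, hc, h3⟩ := h
    exact Or.inr (hasEmptyPseudoTriangle_six hS ha hb hc h3)

theorem theorem4 :
    (holeOrPseudoTriangleSizes 6 6).Nonempty ∧ 12 ≤ E 6 6 ∧ E 6 6 ≤ 18 := by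
  refine ⟨⟨18, eighteen_mem_holeOrPseudoTriangleSizes⟩, ?_,
    Nat.sInf_le eighteen_mem_holeOrPseudoTriangleSizes⟩
  refine le_csInf ⟨18, eighteen_mem_holeOrPseudoTriangleSizes⟩ fun n hn => ?_
  by_contra hlt
  -- Membership of `n` concerns all sets with at least `n` points, so the eleven points refute every
  -- `n ≤ 11` at once.
  rcases hn elevenPoints (by rw [card_elevenPoints]; omega) inGeneralPosition_elevenPoints with h | h
  · exact not_hasHole_elevenPoints h
  · exact not_hasEmptyPseudoTriangle_elevenPoints h
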